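/- Let $G$ be a Lie group with Lie algebra $\mathfrak g=T_1G$ (bracket of left-invariant vector fields), acting smoothly from the left on a (finite-dimensional, Hausdorff) smooth manifold $M$, and let $\mu\colon M\to\mathfrak g^*$ be a smooth equivariant map, $\langle\mu(gm),X\rangle=\langle\mu(m),\mathrm{Ad}_{g^{-1}}X\rangle$ (for instance the moment map of a Hamiltonian action on a symplectic manifold). Write $\mu^X=\langle\mu,X\rangle$. Let $\mathcal Z=(M,\ C^\infty(M)\otimes\bigwedge^{-\bullet}\mathfrak g,\ \delta=\iota_\mu)$ be the derived zero locus of $\mu$, where $\mathfrak g$ has degree $-1$ and $\delta X=\mu^X$ for $X\in\mathfrak g$; likewise $C^\infty(G\times\mathcal Z)=C^\infty(G\times M)\otimes\bigwedge^{-\bullet}\mathfrak g$, with differential the contraction with the pullback of $\mu$. The action groupoid $\mathcal Z/G=(G\times\mathcal Z\rightrightarrows\mathcal Z)$ has source $s=\mathrm{pr}_{\mathcal Z}$, target $t$ with $(t^*f)(g,m)=f(gm)$ for $f\in C^\infty(M)$ and $(t^*X)(g,m)=\mathrm{Ad}_{g^{-1}}X$ for $X\in\mathfrak g$, and unit $u(m)=(1,m)$.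 Let $A$ be the graded $C^\infty(\mathcal Z)$-module whose degree $n$ part consists of the linear maps $\alpha\colon C^\infty(G\times\mathcal Z)\to C^\infty(\mathcal Z)$ of degree $n$ with $\alpha(fh)=\alpha(f)\,u^*h+(-1)^{n|f|}u^*f\,\alpha(h)$ and $\alpha\circ s^*=0$, with differential $\delta_A\alpha=\delta\circ\alpha-(-1)^{n}\alpha\circ\delta$ and anchor $\rho(\alpha)=\alpha\circ t^*$. Let $T_{\mathcal Z}$ be the graded module of $C^\infty$-derivations of $C^\infty(\mathcal Z)$. The pairs in $\iota_{\mathcal Z}^*T_M\oplus \mathfrak g^*_{\mathcal Z}[-1]$, where $\iota_{\mathcal Z}^*T_M=C^\infty(\mathcal Z)\otimes_{C^\infty(M)}T_M$ and $\mathfrak g^*_{\mathcal Z}=C^\infty(\mathcal Z)\otimes\mathfrak g^*$, are viewed as derivations by letting $a\otimes W$ act as $a\,(W\otimes\mathrm{id})$ and $a\otimes\sigma$ as $a\,\iota_\sigma$. Then: 1. There is an isomorphism of dg-$C^\infty(\mathcal Z)$-modules $\Psi\colon C^\infty(\mathcal Z)\otimes\mathfrak g\to A$ such that, for $X\in\mathfrak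 g$ and $f\in C^\infty(G\times M)$, $\Psi(1\otimes X)(f)$ is the function $m\mapsto \left.d\big(g\mapsto f(g,m)\big)\right|_{g=1}(X)$ on $M$. 2. The anchor takes values in $T_{\mathcal Z}$, and $\rho\circ\Psi=\rho_0+\eta$. Here $\rho_0\colon C^\infty(\mathcal Z)\otimes\mathfrak g\to\iota_{\mathcal Z}^*T_M$ is the $C^\infty(\mathcal Z)$-linear extension of the infinitesimal action $X\mapsto X^\sharp$, where $X^\sharp_m$ is the derivative at $g=1$ of $g\mapsto gm$ in the direction $X$. The map $\eta\colon C^\infty(\mathcal Z)\otimes\mathfrak g\to C^\infty(\mathcal Z)\otimes\mathfrak g^*[-1]$ is $C^\infty(\mathcal Z)$-linear with $\eta(1\otimes X)=\mathrm{ad}^*_X$, $\langle\mathrm{ad}^*_X\sigma,Y\rangle=-\langle\sigma,[X,Y]\rangle$, viewed as an element of $\mathfrak g\otimes\mathfrak g^*\subseteq C^\infty(\mathcal Z)_{-1}\otimes\mathfrak g^*$. 3. $\eta$ is a chain homotopy between $d\mu\circ\rho_0$ and $0$: let $d\mu\colon\iota_{\mathcal Z}^*T_M\to\mathfrak g^*_{\mathcal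 Z}$ be the $C^\infty(\mathcal Z)$-linear map sending $W\in T_M$ to $W(\mu)\in C^\infty(M)\otimes\mathfrak g^*$, and let $h(a\otimes X)=(-1)^{|a|}a\,\mathrm{ad}^*_X$ be $\eta$ regarded as a map $\mathfrak g_{\mathcal Z}\to\mathfrak g^*_{\mathcal Z}$ of degree $-1$, where $\mathfrak g_{\mathcal Z}=C^\infty(\mathcal Z)\otimes\mathfrak g$; then $d\mu\circ\rho_0=\delta\circ h+h\circ\delta$, with differentials $\delta\otimes\mathrm{id}$ on $\mathfrak g_{\mathcal Z}$ and $\mathfrak g^*_{\mathcal Z}$. 4. With the anchor $\rho_0+\eta$, the dg-module $C^\infty(\mathcal Z)\otimes\mathfrak g\cong A$ is a dg-Lie algebroid over $\mathcal Z$ (a dg-Lie algebra whose anchor is a morphism of dg-modules and of Lie algebras and which satisfies $[x,a y]=(-1)^{|x||a|}a[x,y]+\rho(x)(a)\,y$), with bracket induced from the Lie bracket of $\mathfrak g$ (with the sign that belongs to right-invariant vector fields): $[1\otimes X,1\otimes Y]=-1\otimes[X,Y]$. -/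

import Mathlib

open scoped TensorProduct Manifold ContDiff

noncomputable section

namespace DerivedReduction

/-! ### Graded derivations and dg-Lie algebroids

A graded object is recorded by its total space together with the family of its homogeneous parts.
-/

section Graded

variable {B A : Type*} [Ring B] [Algebra ℝ B] [Ring A] [Algebra ℝ A]

/-- For a morphism `φ : B → A` of graded algebras, the space of `φ`-derivations of degree `n`:
linear maps `α : B → A` of degree `n` with
`α (g h) = α g * φ h + (-1) ^ (n |g|) φ g * α h` for homogeneous `g, h`. -/
def gradedDerivation (𝓑 : ℤ → Submodule ℝ B) (𝓐 : ℤ → Submodule ℝ A) (φ : B →ₐ[ℝ] A) (n : ℤ) :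
    Submodule ℝ (B →ₗ[ℝ] A) where
  carrier := {α | (∀ k, ∀ g ∈ 𝓑 k, α g ∈ 𝓐 (k + n)) ∧
    ∀ k, ∀ g ∈ 𝓑 k, ∀ l, ∀ h ∈ 𝓑 l,
      α (g * h) = α g * φ h + (-1 : ℝ) ^ (n * k) • (φ g * α h)}
  add_mem' := by
    rintro α β ⟨hα, hα'⟩ ⟨hβ, hβ'⟩
    refine ⟨fun k g hg => add_mem (hα k g hg) (hβ k g hg), fun k g hg l h hh => ?_⟩
    simp only [LinearMap.add_apply, hα' k g hg l h hh, hβ' k g hg l h hh, add_mul, mul_add, smul_add]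
    abel
  zero_mem' := ⟨fun _ _ _ => by simp, fun _ _ _ _ _ _ => by simp⟩
  smul_mem' := by
    rintro c α ⟨hα, hα'⟩
    refine ⟨fun k g hg => Submodule.smul_mem _ c (hα k g hg), fun k g hg l h hh => ?_⟩
    simp only [LinearMap.smul_apply, hα' k g hg l h hh, smul_add, smul_mul_assoc, mul_smul_comm]
    rw [smul_comm c]

/-- The differential `α ↦ δ_A ∘ α - (-1) ^ n α ∘ δ_B` on linear maps of degree `n`. -/
def homDifferential (δB : B →ₗ[ℝ] B) (δA : A →ₗ[ℝ] A) (n : ℤ) (α : B →ₗ[ℝ] A) : B →ₗ[ℝ] A :=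
  δA ∘ₗ α - (-1 : ℝ) ^ n • (α ∘ₗ δB)

/-- The bracket `br` and the anchor `ρ` make the dg-module `L` (with homogeneous parts `𝓛` and
differential `δL`) over the dg-algebra `A` a dg-Lie algebroid; here `𝓣 n` is the space of
vector fields of degree `n`, i.e. of derivations of `A` in which the anchor takes its values. -/
structure IsDGLieAlgebroid (𝓐 : ℤ → Submodule ℝ A) (δA : A →ₗ[ℝ] A)
    (𝓣 : ℤ → Submodule ℝ (Module.End ℝ A))
    {L : Type*} [AddCommGroup L] [Module ℝ L] [Module A L]
    (𝓛 : ℤ → Submodule ℝ L) (δL : L →ₗ[ℝ] L)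
    (ρ : L →ₗ[A] Module.End ℝ A) (br : L →ₗ[ℝ] L →ₗ[ℝ] L) : Prop where
  smul_mem : ∀ m n, ∀ a ∈ 𝓐 m, ∀ x ∈ 𝓛 n, a • x ∈ 𝓛 (m + n)
  diff_mem : ∀ n, ∀ x ∈ 𝓛 n, δL x ∈ 𝓛 (n + 1)
  diff_diff : ∀ x, δL (δL x) = 0
  diff_smul : ∀ m, ∀ a ∈ 𝓐 m, ∀ x, δL (a • x) = δA a • x + (-1 : ℝ) ^ m • (a • δL x)
  lie_mem : ∀ m n, ∀ x ∈ 𝓛 m, ∀ y ∈ 𝓛 n, br x y ∈ 𝓛 (m + n)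
  lie_skew : ∀ m n, ∀ x ∈ 𝓛 m, ∀ y ∈ 𝓛 n, br x y = -((-1 : ℝ) ^ (m * n) • br y x)
  jacobi : ∀ m n, ∀ x ∈ 𝓛 m, ∀ y ∈ 𝓛 n, ∀ z,
    br x (br y z) = br (br x y) z + (-1 : ℝ) ^ (m * n) • br y (br x z)
  diff_lie : ∀ m, ∀ x ∈ 𝓛 m, ∀ y, δL (br x y) = br (δL x) y + (-1 : ℝ) ^ m • br x (δL y)
  anchor_mem : ∀ n, ∀ x ∈ 𝓛 n, ρ x ∈ 𝓣 n
  anchor_diff : ∀ n, ∀ x ∈ 𝓛 n, ρ (δL x) = homDifferential δA δA n (ρ x)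
  anchor_lie : ∀ m n, ∀ x ∈ 𝓛 m, ∀ y ∈ 𝓛 n,
    ρ (br x y) = ρ x ∘ₗ ρ y - (-1 : ℝ) ^ (m * n) • (ρ y ∘ₗ ρ x)
  lie_smul : ∀ m k, ∀ x ∈ 𝓛 m, ∀ a ∈ 𝓐 k, ∀ y,
    br x (a • y) = (-1 : ℝ) ^ (m * k) • (a • br x y) + ρ x a • y

/-- The `A`-linear extension `a ⊗ w ↦ a • f w` of a linear map `f : W → P` to an `A`-module. -/
def extendScalars {W P : Type*} [AddCommGroup W] [Module ℝ W] [AddCommGroup P]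
    [Module ℝ P] [Module A P] [IsScalarTower ℝ A P] [SMulCommClass ℝ A P] (f : W →ₗ[ℝ] P) :
    A ⊗[ℝ] W →ₗ[A] P :=
  TensorProduct.AlgebraTensorModule.lift (LinearMap.toSpanSingleton A (W →ₗ[ℝ] P) f)

end Graded

/-! ### The algebra `R ⊗ ⋀^{-•} V` -/

section Koszul

variable (R : Type*) [CommRing R] [Algebra ℝ R] (V : Type*) [AddCommGroup V] [Module ℝ V]

/-- The algebra `R ⊗ ⋀^{-•} V`. For `R = C^∞(N)` it is the algebra of functions on the quasi-smooth
dg-manifold given by a section of the trivial bundle `N × V^*`. -/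
abbrev Koszul : Type _ := R ⊗[ℝ] ExteriorAlgebra ℝ V

namespace Koszul

/-- The homogeneous part of degree `n` of `R ⊗ ⋀^{-•} V`: the exterior power `⋀^k V` sits in
degree `-k`. -/
def degree (n : ℤ) : Submodule ℝ (Koszul R V) :=
  if n ≤ 0 then LinearMap.range (LinearMap.lTensor R (⋀[ℝ]^n.natAbs V).subtype) else ⊥

/-- The homogeneous part of degree `n` of `(R ⊗ ⋀^{-•} V) ⊗ W` for a vector space `W` in
degree `0`. -/
def freeDegree (W : Type*) [AddCommGroup W] [Module ℝ W] (n : ℤ) :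
    Submodule ℝ (Koszul R V ⊗[ℝ] W) :=
  LinearMap.range (LinearMap.rTensor W (degree R V n).subtype)

variable {R V}

/-- The inclusion of `R`, the degree `0` part. -/
def ofBase : R →ₐ[ℝ] Koszul R V := Algebra.TensorProduct.includeLeft

/-- The inclusion of the generators `V`, in degree `-1`. -/
def generator : V →ₗ[ℝ] Koszul R V :=
  TensorProduct.mk ℝ R (ExteriorAlgebra ℝ V) 1 ∘ₗ ExteriorAlgebra.ι ℝ

/-- The map `a ↦ (-1) ^ |a| a`. -/
def signInvolution : Koszul R V →ₗ[ℝ] Koszul R V :=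
  LinearMap.lTensor R (CliffordAlgebra.involute (Q := (0 : QuadraticForm ℝ V))).toLinearMap

/-- The vertical vector field `a • ι_σ` on `R ⊗ ⋀^{-•} V` attached to `a ⊗ σ`, where `ι_σ` is the
contraction with the constant covector `σ`. -/
def contract : Koszul R V ⊗[ℝ] Module.Dual ℝ V →ₗ[Koszul R V] Module.End ℝ (Koszul R V) :=
  extendScalars (A := Koszul R V) (P := Module.End ℝ (Koszul R V))
    (LinearMap.lTensorHom R ∘ₗ CliffordAlgebra.contractLeft (Q := (0 : QuadraticForm ℝ V)))

theorem ofBase_commute (f : R) (z : Koszul R V) : Commute (ofBase f : Koszul R V) z := by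
  change Commute (f ⊗ₜ[ℝ] (1 : ExteriorAlgebra ℝ V)) z
  induction z using TensorProduct.induction_on with
  | zero => exact Commute.zero_right _
  | add x y hx hy => exact hx.add_right hy
  | tmul r v =>
    simp only [Commute, SemiconjBy, Algebra.TensorProduct.tmul_mul_tmul, one_mul, mul_one, mul_comm]

theorem sq_zero (z : R ⊗[ℝ] V) : (LinearMap.lTensor R (ExteriorAlgebra.ι ℝ) z : Koszul R V) *
    LinearMap.lTensor R (ExteriorAlgebra.ι ℝ) z = 0 := by
  have key : ∀ z w : R ⊗[ℝ] V, (LinearMap.lTensor R (ExteriorAlgebra.ι ℝ) z : Koszul R V) *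
      LinearMap.lTensor R (ExteriorAlgebra.ι ℝ) w + LinearMap.lTensor R (ExteriorAlgebra.ι ℝ) w *
      LinearMap.lTensor R (ExteriorAlgebra.ι ℝ) z = 0 := by
    intro z w
    induction z with
    | zero => simp
    | add x y hx hy =>
      rw [map_add, add_mul, mul_add]
      have h := congrArg₂ (· + ·) hx hy
      simp only [add_zero] at h
      rw [← h]
      abel
    | tmul r v =>
      induction w with
      | zero => simp
      | add x y hx hy =>
        rw [map_add, add_mul, mul_add]
        have h := congrArg₂ (· + ·) hx hy
        simp only [add_zero] at h
        rw [← h]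
        abel
      | tmul s w =>
        simp only [LinearMap.lTensor_tmul, Algebra.TensorProduct.tmul_mul_tmul]
        rw [mul_comm s r, ← TensorProduct.tmul_add, ExteriorAlgebra.ι_add_mul_swap,
          TensorProduct.tmul_zero]
  have h := key z z
  rw [← two_smul ℝ] at h
  exact (smul_eq_zero.mp h).resolve_left two_ne_zero

variable [FiniteDimensional ℝ V]

/-- The canonical identification of `Hom(V, R ⊗ ⋀^{-•} V)` with `(R ⊗ ⋀^{-•} V) ⊗ V^*`. -/
def ofHom : (V →ₗ[ℝ] Koszul R V) →ₗ[ℝ] Koszul R V ⊗[ℝ] Module.Dual ℝ V :=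
  (TensorProduct.comm ℝ _ _).toLinearMap ∘ₗ (dualTensorHomEquiv ℝ V (Koszul R V)).symm.toLinearMap

theorem ofHom_smul (f : R) (ξ : V →ₗ[ℝ] Koszul R V) : ofHom (f • ξ) = f • ofHom ξ := by
  obtain ⟨t, rfl⟩ := (dualTensorHomEquiv ℝ V (Koszul R V)).surjective ξ
  have h : f • (dualTensorHomEquiv ℝ V (Koszul R V)) t = (dualTensorHomEquiv ℝ V (Koszul R V))
      ((TensorProduct.comm ℝ _ _).symm (f • TensorProduct.comm ℝ _ _ t)) := by
    induction t using TensorProduct.induction_on with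
    | zero => simp
    | add x y hx hy => simp only [map_add, smul_add, hx, hy]
    | tmul σ p =>
      ext v
      simp [TensorProduct.smul_tmul', smul_comm f]
  simp only [ofHom, LinearMap.comp_apply, LinearEquiv.coe_coe, h, LinearEquiv.symm_apply_apply,
    LinearEquiv.apply_symm_apply]

/-- The differential `ι_s` on `R ⊗ ⋀^{-•} V`, contraction with the section `s` of `V^*`; the section
is given by the functions `v ↦ ⟨s, v⟩`. -/
def differential (s : V →ₗ[ℝ] R) : Koszul R V →ₗ[ℝ] Koszul R V :=
  contract (ofHom (ofBase.toLinearMap ∘ₗ s))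

end Koszul

end Koszul

/-! ### Smooth functions and vector fields -/

section Smooth

variable {E H : Type*} [NormedAddCommGroup E] [NormedSpace ℝ E] [TopologicalSpace H]
  {I : ModelWithCorners ℝ E H} {M : Type*} [TopologicalSpace M] [ChartedSpace H M]
  {E' H' : Type*} [NormedAddCommGroup E'] [NormedSpace ℝ E'] [TopologicalSpace H']
  {I' : ModelWithCorners ℝ E' H'} {N : Type*} [TopologicalSpace N] [ChartedSpace H' N]

/-- Pullback of functions along a smooth map. -/
def pullback (φ : C^∞⟮I, M; I', N⟯) : C^∞⟮I', N; ℝ⟯ →ₐ[ℝ] C^∞⟮I, M; ℝ⟯ where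
  toFun f := f.comp φ
  map_one' := rfl
  map_mul' _ _ := rfl
  map_zero' := rfl
  map_add' _ _ := rfl
  commutes' _ := rfl

/-- The function `F(a₁, …, a_k)`. -/
def substitute {k : ℕ} (F : (Fin k → ℝ) → ℝ) (hF : ContDiff ℝ ∞ F) (a : Fin k → C^∞⟮I, M; ℝ⟯) :
    C^∞⟮I, M; ℝ⟯ :=
  ⟨fun m => F fun i => a i m, hF.contMDiff.comp (contMDiff_pi_space.2 fun i => (a i).contMDiff)⟩

theorem contDiff_partial {k : ℕ} {F : (Fin k → ℝ) → ℝ} (hF : ContDiff ℝ ∞ F) (i : Fin k) :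
    ContDiff ℝ ∞ (fun x => fderiv ℝ F x (Pi.single i 1)) :=
  (hF.fderiv_right (m := ∞) (by simp)).clm_apply contDiff_const

variable (I M) in
/-- The smooth vector fields on `M`. -/
abbrev VectorFields [IsManifold I ∞ M] : Type _ := Cₛ^∞⟮I; E, (TangentSpace I : M → Type _)⟯

instance vectorFieldsModule [IsManifold I ∞ M] : Module C^∞⟮I, M; ℝ⟯ (VectorFields I M) where
  smul f W := ⟨fun m => f m • W m, f.contMDiff.smul_section W.contMDiff⟩
  one_smul W := by ext m; exact one_smul ℝ (W m)
  mul_smul f g W := by ext m; exact mul_smul (f m) (g m) (W m)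
  smul_zero f := by ext m; exact smul_zero (f m)
  smul_add f V W := by ext m; exact smul_add (f m) (V m) (W m)
  add_smul f g W := by ext m; exact add_smul (f m) (g m) (W m)
  zero_smul W := by ext m; exact zero_smul ℝ (W m)

instance vectorFieldsTower [IsManifold I ∞ M] :
    IsScalarTower ℝ C^∞⟮I, M; ℝ⟯ (VectorFields I M) where
  smul_assoc c f W := by ext m; exact smul_assoc c (f m) (W m)

/-- The derivative `W(f)` of a function along a vector field. -/
def lieDerivative [IsManifold I ∞ M] :
    VectorFields I M →ₗ[C^∞⟮I, M; ℝ⟯] Module.End ℝ C^∞⟮I, M; ℝ⟯ where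
  toFun W :=
    { toFun := fun f => ⟨fun m => mfderiv I 𝓘(ℝ, ℝ) f m (W m),
        contMDiff_snd_tangentBundle_modelSpace ℝ 𝓘(ℝ, ℝ) |>.comp
          ((f.contMDiff.contMDiff_tangentMap (m := ∞) (by simp)).comp W.contMDiff)⟩
      map_add' := fun f g => by
        ext m
        have hf := f.contMDiff.mdifferentiable (by simp) m
        have hg := g.contMDiff.mdifferentiable (by simp) m
        exact congrArg (fun L => L (W m)) (mfderiv_add hf hg)
      map_smul' := fun c f => by
        ext m
        have hf := f.contMDiff.mdifferentiable (by simp) m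
        exact congrArg (fun L => L (W m)) (const_smul_mfderiv hf c) }
  map_add' V W := by
    ext f m
    exact map_add (mfderiv I 𝓘(ℝ, ℝ) f m) (V m) (W m)
  map_smul' g W := by
    ext f m
    exact map_smul (mfderiv I 𝓘(ℝ, ℝ) f m) (g m) (W m)

/-- The tangent module `T_𝒳` of the dg-manifold `𝒳 = (M, C^∞(M) ⊗ ⋀^{-•} V)` in degree `n`: the
derivations of `C^∞(𝒳)` of degree `n` that obey the chain rule on functions of degree `0`. -/
def tangentModule (I : ModelWithCorners ℝ E H) (M : Type*) [TopologicalSpace M] [ChartedSpace H M]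
    (V : Type*) [AddCommGroup V] [Module ℝ V] (n : ℤ) :
    Submodule ℝ (Module.End ℝ (Koszul C^∞⟮I, M; ℝ⟯ V)) :=
  gradedDerivation (Koszul.degree C^∞⟮I, M; ℝ⟯ V) (Koszul.degree C^∞⟮I, M; ℝ⟯ V) (AlgHom.id ℝ _) n ⊓
  { carrier := {D | ∀ (k : ℕ) (F : (Fin k → ℝ) → ℝ) (hF : ContDiff ℝ ∞ F)
      (a : Fin k → C^∞⟮I, M; ℝ⟯),
        D (Koszul.ofBase (substitute F hF a)) =
          ∑ i, Koszul.ofBase (substitute _ (contDiff_partial hF i) a) * D (Koszul.ofBase (a i))}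
    add_mem' := fun hD hD' k F hF a => by
      simp only [LinearMap.add_apply, hD k F hF a, hD' k F hF a, mul_add, Finset.sum_add_distrib]
    zero_mem' := fun k F hF a => by simp
    smul_mem' := fun c D hD k F hF a => by
      simp only [LinearMap.smul_apply, hD k F hF a, mul_smul_comm, Finset.smul_sum] }

end Smooth

/-! ### Lie groups acting on manifolds -/

section Action

set_option linter.unusedSectionVars false

variable {F E : Type*} [NormedAddCommGroup F] [NormedSpace ℝ F] [FiniteDimensional ℝ F]
  [NormedAddCommGroup E] [NormedSpace ℝ E]
  {G : Type*} [TopologicalSpace G] [ChartedSpace F G] [Group G] [LieGroup 𝓘(ℝ, F) ∞ G]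
  {M : Type*} [TopologicalSpace M] [ChartedSpace E M] [IsManifold 𝓘(ℝ, E) ∞ M]
  [MulAction G M] [ContMDiffSMul 𝓘(ℝ, F) 𝓘(ℝ, E) ∞ G M]

instance lieGroupMinSmoothness : LieGroup 𝓘(ℝ, F) (minSmoothness ℝ 3) G := by
  rw [minSmoothness_of_isRCLikeNormedField]
  infer_instance

instance groupLieAlgebraFinite : FiniteDimensional ℝ (GroupLieAlgebra 𝓘(ℝ, F) G) :=
  inferInstanceAs (FiniteDimensional ℝ F)

/-- The adjoint action `Ad_g`, the differential at `1` of `h ↦ g h g⁻¹`, on the vector space `F`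
underlying the Lie algebra `T_1 G`. -/
def adjoint (g : G) : F →L[ℝ] F :=
  mfderiv 𝓘(ℝ, F) 𝓘(ℝ, F) (fun h : G => g * h * g⁻¹) 1

theorem contMDiff_adjoint :
    ContMDiff 𝓘(ℝ, F) 𝓘(ℝ, F →L[ℝ] F) ∞ (adjoint : G → F →L[ℝ] F) := by
  intro g₀
  have hf : ContMDiff (𝓘(ℝ, F).prod 𝓘(ℝ, F)) 𝓘(ℝ, F) ∞
      (Function.uncurry fun g h : G => g * h * g⁻¹) :=
    (contMDiff_fst.mul contMDiff_snd).mul contMDiff_fst.inv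
  have h := ContMDiffAt.mfderiv (m := ∞) (n := ∞) (x₀ := g₀) (fun g h : G => g * h * g⁻¹)
    (fun _ => 1) (hf _) contMDiffAt_const (by simp)
  refine h.congr_of_eventuallyEq (Filter.Eventually.of_forall fun g => ?_)
  have e : (fun k : G => k * 1 * k⁻¹) = fun _ => 1 := by ext k; simp
  have h1 := inTangentCoordinates_eq (I := 𝓘(ℝ, F)) (I' := 𝓘(ℝ, F)) (fun _ : G => (1 : G))
    (fun _ : G => (1 : G)) (fun k => (adjoint k : F →L[ℝ] F)) (x₀ := g₀) (x := g)
    (mem_chart_source F _) (mem_chart_source F _)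
  change adjoint g = inTangentCoordinates 𝓘(ℝ, F) 𝓘(ℝ, F) (fun _ : G => (1 : G))
    (fun k : G => k * 1 * k⁻¹) (fun k => (adjoint k : F →L[ℝ] F)) g₀ g
  rw [e, h1]
  ext v
  simp only [ContinuousLinearMap.comp_apply]
  rw [(tangentBundleCore 𝓘(ℝ, F) G).coordChange_self _ _ (mem_chart_source F _),
    (tangentBundleCore 𝓘(ℝ, F) G).coordChange_self _ _ (mem_chart_source F _)]

variable (F G) in
/-- The Lie algebra `𝔤 = T_1 G`, with the bracket of left-invariant vector fields. -/
abbrev LieAlg : Type _ := GroupLieAlgebra 𝓘(ℝ, F) G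

/-- The map `X ↦ ad^*_X`, where `(ad^*_X σ)(Y) = -σ([X, Y])`. -/
def coadjoint : LieAlg F G →ₗ[ℝ] Module.End ℝ (Module.Dual ℝ (LieAlg F G)) where
  toFun X := -(LieAlgebra.ad ℝ (LieAlg F G) X).dualMap
  map_add' X Y := by
    ext σ Z
    simp [add_comm]
  map_smul' c X := by
    ext σ Z
    simp

variable (G) in
/-- The canonical identification of `𝔤𝔩(𝔤^*)` with `𝔤 ⊗ 𝔤^*`, inverse to
`Y ⊗ τ ↦ (σ ↦ σ(Y) τ)`. -/
def endDualEquiv :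
    Module.End ℝ (Module.Dual ℝ (LieAlg F G)) ≃ₗ[ℝ] LieAlg F G ⊗[ℝ] Module.Dual ℝ (LieAlg F G) :=
  (dualTensorHomEquiv ℝ (Module.Dual ℝ (LieAlg F G)) (Module.Dual ℝ (LieAlg F G))).symm ≪≫ₗ
    TensorProduct.congr (Module.evalEquiv ℝ (LieAlg F G)).symm (LinearEquiv.refl ℝ _)

theorem contMDiff_fundamental (v : F) : ContMDiff 𝓘(ℝ, E) (𝓘(ℝ, E).prod 𝓘(ℝ, E)) ∞
    (fun m : M => (⟨m, (mfderiv 𝓘(ℝ, F) 𝓘(ℝ, E) (fun g : G => g • m) 1 : F →L[ℝ] E) v⟩ :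
      TangentBundle 𝓘(ℝ, E) M)) := by
  have hact : ContMDiff (𝓘(ℝ, F).prod 𝓘(ℝ, E)) 𝓘(ℝ, E) ∞ (fun p : G × M => p.1 • p.2) :=
    contMDiff_smul
  let fg : M → TangentBundle 𝓘(ℝ, E) M := fun m => Bundle.TotalSpace.mk' E m 0
  have sfg : ContMDiff 𝓘(ℝ, E) (𝓘(ℝ, E).prod 𝓘(ℝ, E)) ∞ fg := Bundle.contMDiff_zeroSection _ _
  let fv : M → TangentBundle 𝓘(ℝ, F) G := fun _ => Bundle.TotalSpace.mk' F 1 v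
  have sfv : ContMDiff 𝓘(ℝ, E) (𝓘(ℝ, F).prod 𝓘(ℝ, F)) ∞ fv := contMDiff_const
  have S := ((hact.contMDiff_tangentMap (m := ∞) (by simp)).comp
    (contMDiff_equivTangentBundleProd_symm (I := 𝓘(ℝ, F)) (M := G) (I' := 𝓘(ℝ, E)) (M' := M)
      (n := ∞))).comp (sfv.prodMk sfg)
  have aux : ∀ {a b : M} (_ : a = b) {v w : E} (_ : v = w),
      (⟨a, v⟩ : TangentBundle 𝓘(ℝ, E) M) = ⟨b, w⟩ := by
    rintro a b rfl v w rfl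
    rfl
  convert! S with m
  refine aux (one_smul G m).symm ?_
  refine Eq.trans ?_ (mfderiv_prod_eq_add_apply (hact.mdifferentiable (by simp) _)).symm
  let D₁ : F →L[ℝ] E := mfderiv 𝓘(ℝ, F) 𝓘(ℝ, E) (fun g : G => g • m) 1
  let D₂ : E →L[ℝ] E := mfderiv 𝓘(ℝ, E) 𝓘(ℝ, E) (fun x : M => (1 : G) • x) m
  change D₁ v = D₁ v + D₂ 0
  rw [map_zero, add_zero]

/-- The fundamental vector field `X^♯` of `X ∈ 𝔤` on `M`, the derivative at `g = 1` in the
direction `X` of `g ↦ g • m`. -/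
def fundamentalField : LieAlg F G →ₗ[ℝ] VectorFields 𝓘(ℝ, E) M where
  toFun X := ⟨fun m =>
    let D : F →L[ℝ] E := mfderiv 𝓘(ℝ, F) 𝓘(ℝ, E) (fun g : G => g • m) 1
    D X, contMDiff_fundamental (F := F) X⟩
  map_add' X Y := by
    ext m
    exact map_add (mfderiv 𝓘(ℝ, F) 𝓘(ℝ, E) (fun g : G => g • m) 1 : F →L[ℝ] E) X Y
  map_smul' c X := by
    ext m
    exact map_smul (mfderiv 𝓘(ℝ, F) 𝓘(ℝ, E) (fun g : G => g • m) 1 : F →L[ℝ] E) c X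

variable (F E G M) in
/-- A smooth map `μ : M → 𝔤^*` that is equivariant for the coadjoint action:
`⟨μ(g • m), X⟩ = ⟨μ(m), Ad_{g⁻¹} X⟩`. (`F` is the vector space underlying `𝔤`.) -/
structure MomentMap where
  toFun : M → F →L[ℝ] ℝ
  contMDiff : ContMDiff 𝓘(ℝ, E) 𝓘(ℝ, F →L[ℝ] ℝ) ∞ toFun
  equivariant : ∀ (g : G) (m : M) (X : F), toFun (g • m) X = toFun m (adjoint g⁻¹ X)

variable (F E G M) in
/-- The functions on `𝒵`, namely `C^∞(𝒵) = C^∞(M) ⊗ ⋀^{-•} 𝔤`. -/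
abbrev FnZ : Type _ := Koszul C^∞⟮𝓘(ℝ, E), M; ℝ⟯ (LieAlg F G)

variable (F E G M) in
/-- The functions on `G × 𝒵`, namely `C^∞(G × 𝒵) = C^∞(G × M) ⊗ ⋀^{-•} 𝔤`. -/
abbrev FnGZ : Type _ := Koszul C^∞⟮𝓘(ℝ, F).prod 𝓘(ℝ, E), G × M; ℝ⟯ (LieAlg F G)

theorem MomentMap.contMDiff_apply (μ : MomentMap F E G M) (v : F) :
    ContMDiff 𝓘(ℝ, E) 𝓘(ℝ, ℝ) ∞ (fun m => μ.toFun m v) :=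
  μ.contMDiff.clm_apply contMDiff_const

/-- The functions `X ↦ μ^X = ⟨μ, X⟩` on `M`. -/
def MomentMap.comoment (μ : MomentMap F E G M) : LieAlg F G →ₗ[ℝ] C^∞⟮𝓘(ℝ, E), M; ℝ⟯ where
  toFun X := ⟨fun m => μ.toFun m X, μ.contMDiff_apply X⟩
  map_add' X Y := by
    ext m
    exact map_add (μ.toFun m) (X : F) (Y : F)
  map_smul' c X := by
    ext m
    exact map_smul (μ.toFun m) c (X : F)

variable (F E G M) in
/-- The projection `G × M → M`, as a smooth map. -/
def proj : C^∞⟮𝓘(ℝ, F).prod 𝓘(ℝ, E), G × M; 𝓘(ℝ, E), M⟯ := ⟨Prod.snd, contMDiff_snd⟩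

variable (F E G M) in
/-- The action `G × M → M`, as a smooth map. -/
def act : C^∞⟮𝓘(ℝ, F).prod 𝓘(ℝ, E), G × M; 𝓘(ℝ, E), M⟯ := ⟨fun p => p.1 • p.2, contMDiff_smul⟩

variable (F E G M) in
/-- The map `m ↦ (1, m)`, as a smooth map. -/
def unit : C^∞⟮𝓘(ℝ, E), M; 𝓘(ℝ, F).prod 𝓘(ℝ, E), G × M⟯ :=
  ⟨fun m => (1, m), contMDiff_const.prodMk contMDiff_id⟩

/-- The differential `ι_μ` of `C^∞(𝒵)`. -/
def MomentMap.diffZ (μ : MomentMap F E G M) : FnZ F E G M →ₗ[ℝ] FnZ F E G M :=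
  Koszul.differential μ.comoment

/-- The differential of `C^∞(G × 𝒵)`, contraction with the pullback of `μ` to `G × M`. -/
def MomentMap.diffGZ (μ : MomentMap F E G M) : FnGZ F E G M →ₗ[ℝ] FnGZ F E G M :=
  Koszul.differential ((pullback (proj F E G M)).toLinearMap ∘ₗ μ.comoment)

variable (F E G M) in
/-- The pullback `s^*` along the source `s = pr : G × 𝒵 → 𝒵`. -/
def sourcePullback : FnZ F E G M →ₐ[ℝ] FnGZ F E G M :=
  Algebra.TensorProduct.map (pullback (proj F E G M)) (AlgHom.id ℝ _)

variable (F E G M) in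
/-- The pullback `u^*` along the unit `u : 𝒵 → G × 𝒵`. -/
def unitPullback : FnGZ F E G M →ₐ[ℝ] FnZ F E G M :=
  Algebra.TensorProduct.map (pullback (unit F E G M)) (AlgHom.id ℝ _)

theorem contMDiff_adjoint_coeff (σ : F →ₗ[ℝ] ℝ) (v : F) :
    ContMDiff (𝓘(ℝ, F).prod 𝓘(ℝ, E)) 𝓘(ℝ, ℝ) ∞ (fun p : G × M => σ (adjoint p.1⁻¹ v)) :=
  (LinearMap.toContinuousLinearMap σ).contMDiff.comp
    ((contMDiff_adjoint.comp contMDiff_fst.inv).clm_apply contMDiff_const)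

variable (E M) in
/-- The function `(g, m) ↦ ⟨σ, Ad_{g⁻¹} X⟩` on `G × M`. -/
def adjointCoeff (σ : Module.Dual ℝ (LieAlg F G)) :
    LieAlg F G →ₗ[ℝ] C^∞⟮𝓘(ℝ, F).prod 𝓘(ℝ, E), G × M; ℝ⟯ where
  toFun X := ⟨fun p => σ (adjoint (F := F) p.1⁻¹ X), contMDiff_adjoint_coeff (F := F) σ X⟩
  map_add' X Y := by
    ext p
    exact (congrArg σ (map_add (adjoint p.1⁻¹ : F →L[ℝ] F) X Y)).trans (map_add σ _ _)
  map_smul' c X := by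
    ext p
    exact (congrArg σ (map_smul (adjoint p.1⁻¹ : F →L[ℝ] F) c X)).trans (map_smul σ _ _)

variable (F E G M) in
/-- The element `Ad_{g⁻¹} X` of `C^∞(G × M) ⊗ 𝔤`, written out in a basis of `𝔤`. -/
def adjointTensor :
    LieAlg F G →ₗ[ℝ] C^∞⟮𝓘(ℝ, F).prod 𝓘(ℝ, E), G × M; ℝ⟯ ⊗[ℝ] LieAlg F G :=
  ∑ i, (TensorProduct.mk ℝ C^∞⟮𝓘(ℝ, F).prod 𝓘(ℝ, E), G × M; ℝ⟯ (LieAlg F G)).flip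
    (Module.finBasis ℝ (LieAlg F G) i) ∘ₗ
      adjointCoeff E M ((Module.finBasis ℝ (LieAlg F G)).coord i)

variable (F E G M) in
/-- The pullback `t^*` along the target `t : G × 𝒵 → 𝒵`, the action: `(t^* f)(g, m) = f(g • m)` for
`f ∈ C^∞(M)` and `(t^* X)(g, m) = Ad_{g⁻¹} X` for `X ∈ 𝔤`. -/
def targetPullback : FnZ F E G M →ₐ[ℝ] FnGZ F E G M :=
  Algebra.TensorProduct.lift (Koszul.ofBase.comp (pullback (act F E G M)))
    (ExteriorAlgebra.lift ℝ
      ⟨LinearMap.lTensor C^∞⟮𝓘(ℝ, F).prod 𝓘(ℝ, E), G × M; ℝ⟯ (ExteriorAlgebra.ι ℝ) ∘ₗ adjointTensor F E G M,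
        fun _ => Koszul.sq_zero _⟩)
    (fun _ _ => Koszul.ofBase_commute _ _)

variable (F E G M) in
/-- The underlying graded module `A = Der^s_u(C^∞(G × 𝒵), C^∞(𝒵))` of the dg-Lie algebroid of the
action groupoid, in degree `n`: the `u`-derivations of degree `n` that vanish along the source. Its
differential is `homDifferential`. -/
def algebroid (n : ℤ) : Submodule ℝ (FnGZ F E G M →ₗ[ℝ] FnZ F E G M) :=
  gradedDerivation (Koszul.degree _ _) (Koszul.degree _ _) (unitPullback F E G M) n ⊓
  { carrier := {α | ∀ h, α (sourcePullback F E G M h) = 0}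
    add_mem' := fun hα hβ h => by simp [hα h, hβ h]
    zero_mem' := fun h => by simp
    smul_mem' := fun c α hα h => by simp [hα h] }

variable (F E G M) in
/-- The anchor `α ↦ α ∘ t^*`. -/
def anchor : (FnGZ F E G M →ₗ[ℝ] FnZ F E G M) →ₗ[FnZ F E G M] Module.End ℝ (FnZ F E G M) where
  toFun α := α ∘ₗ (targetPullback F E G M).toLinearMap
  map_add' _ _ := rfl
  map_smul' _ _ := rfl

variable (F E G M) in
/-- The pullback `ι_𝒵^* T_M` of the module of vector fields on `M`. -/
abbrev HorizontalZ : Type _ :=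
  FnZ F E G M ⊗[C^∞⟮𝓘(ℝ, E), M; ℝ⟯] VectorFields 𝓘(ℝ, E) M

variable (F E G M) in
/-- The trivial module `C^∞(𝒵) ⊗ 𝔤`. -/
abbrev TrivZ : Type _ := FnZ F E G M ⊗[ℝ] LieAlg F G

variable (F E G M) in
/-- The trivial module `C^∞(𝒵) ⊗ 𝔤^*`. -/
abbrev DualTrivZ : Type _ := FnZ F E G M ⊗[ℝ] Module.Dual ℝ (LieAlg F G)

variable (F E G M) in
/-- The homogeneous part of degree `n` of `C^∞(𝒵) ⊗ 𝔤`. -/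
def trivDegree (n : ℤ) : Submodule ℝ (TrivZ F E G M) :=
  Koszul.freeDegree C^∞⟮𝓘(ℝ, E), M; ℝ⟯ (LieAlg F G) (LieAlg F G) n

variable (F E G M) in
/-- The inclusion `ι_𝒵^* T_M → T_𝒵`: the vector field `a ⊗ W` acts on `C^∞(𝒵) = C^∞(M) ⊗ ⋀^{-•} 𝔤` as
`a • (W ⊗ id)`. -/
def horizontal : HorizontalZ F E G M →ₗ[FnZ F E G M] Module.End ℝ (FnZ F E G M) :=
  TensorProduct.AlgebraTensorModule.lift
    (LinearMap.toSpanSingleton (FnZ F E G M)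
      (VectorFields 𝓘(ℝ, E) M →ₗ[C^∞⟮𝓘(ℝ, E), M; ℝ⟯] Module.End ℝ (FnZ F E G M))
      { toFun := fun W => LinearMap.rTensor _ (lieDerivative W)
        map_add' := fun V W => by rw [map_add, LinearMap.rTensor_add]
        map_smul' := fun f W => by
          refine TensorProduct.ext' fun a w => ?_
          rw [map_smul, RingHom.id_apply, LinearMap.smul_apply, LinearMap.rTensor_tmul,
            LinearMap.rTensor_tmul, LinearMap.smul_apply, TensorProduct.smul_tmul'] })

variable (F E G M) in
/-- The inclusion `ι_𝒵^* T_M ⊕ 𝔤^*_𝒵[-1] → T_𝒵`, `a ⊗ W ↦ a • (W ⊗ id)` and `a ⊗ σ ↦ a • ι_σ`. -/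
def toTangent :
    (HorizontalZ F E G M × DualTrivZ F E G M) →ₗ[FnZ F E G M] Module.End ℝ (FnZ F E G M) :=
  (horizontal F E G M).coprod Koszul.contract

variable (F E G M) in
/-- The infinitesimal action `ρ₀ : C^∞(𝒵) ⊗ 𝔤 → ι_𝒵^* T_M`, the `C^∞(𝒵)`-linear map with
`1 ⊗ X ↦ 1 ⊗ X^♯`. -/
def rhoZero : TrivZ F E G M →ₗ[FnZ F E G M] HorizontalZ F E G M :=
  extendScalars
    { toFun := fun X => 1 ⊗ₜ fundamentalField X
      map_add' := fun X Y => by rw [map_add, TensorProduct.tmul_add]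
      map_smul' := fun c X => by rw [map_smul, TensorProduct.tmul_smul, RingHom.id_apply] }

variable (F E G M) in
/-- The `C^∞(𝒵)`-linear map `η : C^∞(𝒵) ⊗ 𝔤 → C^∞(𝒵) ⊗ 𝔤^*[-1]` with `η(1 ⊗ X) = ad^*_X`, viewed as an
element of `𝔤 ⊗ 𝔤^* ⊆ C^∞(𝒵)_{-1} ⊗ 𝔤^*`. -/
def eta : TrivZ F E G M →ₗ[FnZ F E G M] DualTrivZ F E G M :=
  extendScalars (A := FnZ F E G M) (P := DualTrivZ F E G M)
    (LinearMap.rTensor _ Koszul.generator ∘ₗ (endDualEquiv G).toLinearMap ∘ₗ coadjoint)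

variable (F E G M) in
/-- The map `η` with the shift of the target undone, as a map `C^∞(𝒵) ⊗ 𝔤 → C^∞(𝒵) ⊗ 𝔤^*` of degree
`-1`: with the sign rule for maps of degree `-1` over `C^∞(𝒵)`, it is
`a ⊗ X ↦ (-1) ^ |a| a • ad^*_X`. -/
def etaHomotopy : TrivZ F E G M →ₗ[ℝ] DualTrivZ F E G M :=
  (eta F E G M).restrictScalars ℝ ∘ₗ LinearMap.rTensor (LieAlg F G) Koszul.signInvolution

/-- The map `dμ : ι_𝒵^* T_M → C^∞(𝒵) ⊗ 𝔤^*`, `a ⊗ W ↦ a • W(μ)`, where `W(μ)` stands for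
`X ↦ W(μ^X)`. -/
def MomentMap.dmu (μ : MomentMap F E G M) :
    HorizontalZ F E G M →ₗ[FnZ F E G M] DualTrivZ F E G M :=
  TensorProduct.AlgebraTensorModule.lift
    (LinearMap.toSpanSingleton (FnZ F E G M)
      (VectorFields 𝓘(ℝ, E) M →ₗ[C^∞⟮𝓘(ℝ, E), M; ℝ⟯] DualTrivZ F E G M)
      { toFun := fun W => Koszul.ofHom (Koszul.ofBase.toLinearMap ∘ₗ lieDerivative W ∘ₗ μ.comoment)
        map_add' := fun V W => by
          rw [map_add, LinearMap.add_comp, LinearMap.comp_add, map_add]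
        map_smul' := fun f W => by
          rw [RingHom.id_apply, ← Koszul.ofHom_smul]
          congr 1
          ext X
          simp [Koszul.ofBase, TensorProduct.smul_tmul'] })

/-- The differential `δ ⊗ id` of the trivial module `C^∞(𝒵) ⊗ W`. -/
def MomentMap.diffTriv (μ : MomentMap F E G M) (W : Type*) [AddCommGroup W] [Module ℝ W] :
    FnZ F E G M ⊗[ℝ] W →ₗ[ℝ] FnZ F E G M ⊗[ℝ] W :=
  LinearMap.rTensor W μ.diffZ

end Action

end DerivedReduction

end

open DerivedReduction

noncomputable section

namespace DerivedReduction

/-! ### Generators, gradings and the differential of `R ⊗ ⋀^{-•} V` -/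

section KoszulAlgebra

variable {R : Type*} [CommRing R] [Algebra ℝ R] {V : Type*} [AddCommGroup V] [Module ℝ V]

namespace Koszul

/-! The algebras here are generated by functions in degree 0 and by vectors in degree -1. An
operator obeying a Leibniz rule is therefore known from its values on these two kinds of elements,
and most algebraic identities are checked there.

An element of A vanishes on the image of `s^*`, so it is determined by its values on functions on G
× M (`algebroid_eq_zero_of_ofBase`). Hadamard's lemma with parameters in M (`exists_hadamard`)
writes such a function as a pullback from M, plus a combination of coordinates of G at 1, plus a
product of two functions that vanish on the unit section. A derivation along the unit that kills
pullbacks from M sees only the coordinates. Hence Ψ is bijective: the values of α on the coordinates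
are the components of its preimage. No locality or chain rule has to be assumed of α. Ψ is a chain
map because the differential on G × 𝒵 has coefficients pulled back from M, which are constants for a
derivative in the G-direction.

The anchor of Ψ(1 ⊗ X), called `actionDeriv`, is a derivation of degree 0 because t ∘ u = id. On
functions it is X^♯. On a generator Y it is the derivative of Ad_{g⁻¹} Y at g = 1, which is -⁅X, Y⁆
(`derivAt_adjoint_inv`). The derivation ρ₀ + η has the same values, so the two agree.

The formula for the derivative of Ad is the essential fact about G. Right translation is left
translation after a conjugation; differentiating this at 1 and using symmetry of second derivatives
expresses the derivative of Ad_{g⁻¹} by the antisymmetrised second derivative of a coordinate map,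
and the bracket of left-invariant fields has the same coordinate expression. The formula also gives
the bracket of fundamental fields and infinitesimal equivariance, X^♯ μ^Y = -μ^{⁅X, Y⁆}
(`lieDerivative_comoment`). The latter yields the chain homotopy, and it makes `actionDeriv` commute
with δ.

The rest is formal: a Lie algebra acting on a graded-commutative dg-algebra by derivations of degree
0 that commute with δ gives a dg-Lie algebroid (`isDGLieAlgebroid_actionBracket`). -/

theorem ofBase_apply (f : R) : (ofBase f : Koszul R V) = f ⊗ₜ 1 := rfl

theorem generator_apply (v : V) : (generator v : Koszul R V) = 1 ⊗ₜ ExteriorAlgebra.ι ℝ v := rfl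

theorem ofBase_mul_tmul (f g : R) (w : ExteriorAlgebra ℝ V) :
    (ofBase f : Koszul R V) * g ⊗ₜ w = (f * g) ⊗ₜ w := by
  rw [ofBase_apply, Algebra.TensorProduct.tmul_mul_tmul, one_mul]

theorem generator_mul_tmul (v : V) (g : R) (w : ExteriorAlgebra ℝ V) :
    (generator v : Koszul R V) * g ⊗ₜ w = g ⊗ₜ (ExteriorAlgebra.ι ℝ v * w) := by
  rw [generator_apply, Algebra.TensorProduct.tmul_mul_tmul, one_mul]

theorem ofBase_comm (f : R) (z : Koszul R V) : ofBase f * z = z * ofBase f := ofBase_commute f z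

theorem ofBase_left_comm (f : R) (y z : Koszul R V) : y * (ofBase f * z) = ofBase f * (y * z) := by
  rw [← mul_assoc, ← ofBase_comm, mul_assoc]

-- Products of vectors applied to a function span the algebra, so a property has only to survive
-- left multiplication by one generator. The form matches the rules known for contractions,
-- differentials and the infinitesimal action.
@[elab_as_elim]
theorem induction {p : Koszul R V → Prop} (z : Koszul R V)
    (ofBase : ∀ f, p (ofBase f)) (generator_mul : ∀ v z, p z → p (generator v * z))
    (add : ∀ y z, p y → p z → p (y + z)) : p z := by
  induction z using TensorProduct.induction_on with
  | zero => simpa using ofBase 0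
  | add y z hy hz => exact add y z hy hz
  | tmul r w =>
    induction w using CliffordAlgebra.left_induction with
    | algebraMap c =>
      rw [Algebra.algebraMap_eq_smul_one, TensorProduct.tmul_smul, TensorProduct.smul_tmul']
      exact ofBase (c • r)
    | add x y hx hy => rw [TensorProduct.tmul_add]; exact add _ _ hx hy
    | ι_mul w v hw =>
      have := generator_mul v _ hw
      rwa [generator_mul_tmul] at this

theorem tmul_mem_degree (r : R) {k : ℕ} {w : ExteriorAlgebra ℝ V} (hw : w ∈ ⋀[ℝ]^k V) :
    r ⊗ₜ w ∈ degree R V (-k) := by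
  rw [degree, if_pos (by simp)]
  have h : (-(k : ℤ)).natAbs = k := by simp
  rw [h]
  exact ⟨r ⊗ₜ ⟨w, hw⟩, rfl⟩

/-- The predicate carries the degree because `degree` is a conditional on `n`: in positive degree
only the zero clause applies, and otherwise `n` has to be replaced by `-k` before the exterior power
can be used. -/
theorem tmul_induction {p : ℤ → Koszul R V → Prop} {n : ℤ} {z : Koszul R V}
    (hz : z ∈ degree R V n) (zero : ∀ n, p n 0) (add : ∀ n y z, p n y → p n z → p n (y + z))
    (tmul : ∀ (k : ℕ) (r : R), ∀ w ∈ ⋀[ℝ]^k V, p (-k) (r ⊗ₜ w)) : p n z := by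
  by_cases hn : n ≤ 0
  · obtain ⟨k, rfl⟩ : ∃ k : ℕ, n = -k := ⟨n.natAbs, by omega⟩
    rw [degree, if_pos hn] at hz
    have h : (-(k : ℤ)).natAbs = k := by simp
    rw [h] at hz
    obtain ⟨y, rfl⟩ := hz
    induction y using TensorProduct.induction_on with
    | zero => rw [map_zero]; exact zero _
    | add x y hx hy => rw [map_add]; exact add _ _ _ hx hy
    | tmul r w => exact tmul k r w.1 w.2
  · rw [degree, if_neg hn, Submodule.mem_bot] at hz
    rw [hz]
    exact zero n

theorem ofBase_mem_degree (f : R) : (ofBase f : Koszul R V) ∈ degree R V 0 :=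
  tmul_mem_degree f (k := 0) (by rw [ExteriorAlgebra.exteriorPower, pow_zero]; exact Submodule.one_le.mp le_rfl)

theorem generator_mul_mem_degree (v : V) {n : ℤ} {z : Koszul R V} (hz : z ∈ degree R V n) :
    generator v * z ∈ degree R V (n - 1) := by
  refine tmul_induction (p := fun n z => generator v * z ∈ degree R V (n - 1)) hz (by simp)
    (fun n y z hy hz => by rw [mul_add]; exact add_mem hy hz) fun k r w hw => ?_
  · have h : (-(k : ℤ) - 1) = -((k + 1 : ℕ) : ℤ) := by push_cast; ring
    rw [generator_mul_tmul, h]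
    refine tmul_mem_degree r ?_
    rw [ExteriorAlgebra.exteriorPower, pow_succ']
    exact Submodule.mul_mem_mul ⟨v, rfl⟩ hw

-- Graded version of `induction`: since ⋀^{k+1} V is V times ⋀^k V, each homogeneous part is reached
-- from degree 0 by multiplying with generators. The degree varies along the induction, so signs
-- depending on it can be tracked.
@[elab_as_elim]
theorem degree_induction {p : ∀ (n : ℤ) (z : Koszul R V), z ∈ degree R V n → Prop} {n : ℤ}
    {z : Koszul R V} (hz : z ∈ degree R V n) (zero : ∀ n, p n 0 (zero_mem _))
    (add : ∀ n y z hy hz, p n y hy → p n z hz → p n (y + z) (add_mem hy hz))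
    (ofBase : ∀ f, p 0 (ofBase f) (ofBase_mem_degree f))
    (generator_mul : ∀ n v z hz, p n z hz →
      p (n - 1) (generator v * z) (generator_mul_mem_degree v hz)) : p n z hz := by
  suffices h : ∃ hz, p n z hz from h.2
  refine tmul_induction (p := fun n z => ∃ hz, p n z hz) hz (fun n => ⟨_, zero n⟩)
    (fun n y z ⟨_, hy⟩ ⟨_, hz⟩ => ⟨_, add n y z _ _ hy hz⟩) fun k r w hw => ?_
  · induction k generalizing w with
    | zero =>
      rw [ExteriorAlgebra.exteriorPower, pow_zero, Submodule.mem_one] at hw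
      obtain ⟨c, rfl⟩ := hw
      rw [Algebra.algebraMap_eq_smul_one, TensorProduct.tmul_smul, TensorProduct.smul_tmul']
      exact ⟨_, ofBase (c • r)⟩
    | succ k ih =>
      rw [ExteriorAlgebra.exteriorPower, pow_succ'] at hw
      have h : -((k + 1 : ℕ) : ℤ) = (-(k : ℤ) - 1) := by push_cast; ring
      rw [h]
      induction hw using Submodule.mul_induction_on' with
      | mem_mul_mem x hx w hw =>
        obtain ⟨v, rfl⟩ := hx
        have : ∃ hz, p _ _ hz := ⟨_, generator_mul _ v _ (tmul_mem_degree r hw) (ih w hw).2⟩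
        rwa [generator_mul_tmul] at this
      | add x _ y _ hx hy => rw [TensorProduct.tmul_add]; exact ⟨_, add _ _ _ _ _ hx.2 hy.2⟩

theorem mul_mem_degree {m n : ℤ} {y z : Koszul R V} (hy : y ∈ degree R V m)
    (hz : z ∈ degree R V n) : y * z ∈ degree R V (m + n) := by
  induction hy using degree_induction with
  | zero m => simp
  | add m x y _ _ hx hy => rw [add_mul]; exact add_mem hx hy
  | ofBase f =>
    rw [zero_add]
    exact tmul_induction (p := fun n z => ofBase f * z ∈ degree R V n) hz (by simp)
      (fun n y z hy hz => by rw [mul_add]; exact add_mem hy hz)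
      fun k r w hw => by rw [ofBase_mul_tmul]; exact tmul_mem_degree _ hw
  | generator_mul m v y _ ih =>
    rw [mul_assoc, show m - 1 + n = m + n - 1 by ring]
    exact generator_mul_mem_degree v ih

theorem generator_mul_generator (v w : V) :
    (generator v : Koszul R V) * generator w = -(generator w * generator v) := by
  rw [eq_neg_iff_add_eq_zero]
  simp only [generator_apply, Algebra.TensorProduct.tmul_mul_tmul, ← TensorProduct.tmul_add,
    ExteriorAlgebra.ι_add_mul_swap, TensorProduct.tmul_zero]

theorem neg_one_zpow_mul_self (n : ℤ) : (-1 : ℝ) ^ n * (-1 : ℝ) ^ n = 1 := by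
  rw [← mul_zpow]; simp

theorem neg_one_zpow_sub_one (n : ℤ) : (-1 : ℝ) ^ (n - 1) = -(-1 : ℝ) ^ n := by
  rw [zpow_sub_one₀ (by norm_num)]; norm_num

theorem generator_mul_comm (v : V) {n : ℤ} {z : Koszul R V} (hz : z ∈ degree R V n) :
    generator v * z = (-1 : ℝ) ^ n • (z * generator v) := by
  induction hz using degree_induction with
  | zero n => simp
  | add n y z _ _ hy hz => rw [mul_add, hy, hz, add_mul, smul_add]
  | ofBase f => rw [ofBase_comm, zpow_zero, one_smul]
  | generator_mul n w z _ ih =>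
    rw [← mul_assoc, generator_mul_generator, neg_mul, mul_assoc, ih, neg_one_zpow_sub_one,
      mul_smul_comm, neg_smul, mul_assoc]

/-- Graded commutativity. -/
theorem mul_comm_degree {m n : ℤ} {y z : Koszul R V} (hy : y ∈ degree R V m)
    (hz : z ∈ degree R V n) : y * z = (-1 : ℝ) ^ (m * n) • (z * y) := by
  induction hy using degree_induction with
  | zero m => simp
  | add m x y _ _ hx hy => rw [add_mul, hx, hy, mul_add, smul_add]
  | ofBase f => rw [ofBase_comm, zero_mul, zpow_zero, one_smul]
  | generator_mul m v y _ ih =>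
    have h : (-1 : ℝ) ^ ((m - 1) * n) = (-1 : ℝ) ^ (m * n) * (-1 : ℝ) ^ n := by
      rw [sub_mul, one_mul, zpow_sub₀ (by norm_num), div_eq_mul_inv, ← inv_zpow]; norm_num
    rw [mul_assoc, ih, mul_smul_comm, ← mul_assoc, generator_mul_comm v hz, smul_mul_assoc,
      smul_smul, h, mul_assoc]

/-- The involution fixes functions and changes sign at each generator, which is the recursion
satisfied by the parity sign. -/
theorem signInvolution_apply {n : ℤ} {z : Koszul R V} (hz : z ∈ degree R V n) :
    signInvolution z = (-1 : ℝ) ^ n • z := by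
  have hb : ∀ f : R, signInvolution (ofBase f : Koszul R V) = ofBase f := fun f => by
    simp [signInvolution, ofBase_apply]
  have hg : ∀ (v : V) (z : Koszul R V),
      signInvolution (generator v * z) = -(generator v * signInvolution z) := fun v z => by
    induction z using TensorProduct.induction_on with
    | zero => simp
    | add y z hy hz => rw [mul_add, map_add, hy, hz, map_add, mul_add, neg_add]
    | tmul r w =>
      rw [generator_mul_tmul, signInvolution, LinearMap.lTensor_tmul, LinearMap.lTensor_tmul,
        generator_mul_tmul, ← TensorProduct.tmul_neg]
      congr 1
      simp [ExteriorAlgebra.ι]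
  induction hz using degree_induction with
  | zero n => simp
  | add n y z _ _ hy hz => rw [map_add, hy, hz, smul_add]
  | ofBase f => rw [hb, zpow_zero, one_smul]
  | generator_mul n w z _ ih => rw [hg, ih, neg_one_zpow_sub_one, mul_smul_comm, neg_smul]

/-- Endomorphisms obeying the same Leibniz rule on generators agree if they agree on `R`. -/
theorem hom_ext_of_leibniz {S T : Module.End ℝ (Koszul R V)} (c : V → Koszul R V)
    (hS : ∀ v z, S (generator v * z) = c v * z + generator v * S z)
    (hT : ∀ v z, T (generator v * z) = c v * z + generator v * T z)
    (h : ∀ f, S (ofBase f) = T (ofBase f)) : S = T := by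
  refine LinearMap.ext fun z => ?_
  induction z using induction with
  | ofBase f => exact h f
  | generator_mul v z hz => rw [hS, hT, hz]
  | add y z hy hz => rw [map_add, map_add, hy, hz]

/-- The span of the homogeneous parts is everything. -/
theorem induction_degree {p : Koszul R V → Prop} (z : Koszul R V)
    (mem : ∀ n, ∀ z ∈ degree R V n, p z) (add : ∀ y z, p y → p z → p (y + z)) : p z := by
  suffices h : z ∈ ⨆ n, degree R V n by
    exact Submodule.iSup_induction _ (motive := p) h mem (mem 0 0 (zero_mem _)) add
  clear mem add
  induction z using induction with
  | ofBase f => exact Submodule.mem_iSup_of_mem 0 (ofBase_mem_degree f)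
  | add y z hy hz => exact add_mem hy hz
  | generator_mul v z hz =>
    induction hz using Submodule.iSup_induction' with
    | zero => simp
    | mem n z hz => exact Submodule.mem_iSup_of_mem (n - 1) (generator_mul_mem_degree v hz)
    | add y z _ _ hy hz => rw [mul_add]; exact add_mem hy hz

/-! ### Contractions -/

theorem contract_tmul (a : Koszul R V) (σ : Module.Dual ℝ V) (z : Koszul R V) :
    contract (a ⊗ₜ σ) z = a * contract (1 ⊗ₜ σ) z := by
  simp [contract, extendScalars]

theorem contract_one_tmul_ofBase (σ : Module.Dual ℝ V) (f : R) :
    contract (1 ⊗ₜ σ) (ofBase f : Koszul R V) = 0 := by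
  simp [contract, extendScalars, ofBase_apply]

theorem contract_one_tmul_generator_mul (σ : Module.Dual ℝ V) (v : V) (z : Koszul R V) :
    contract (1 ⊗ₜ σ) (generator v * z) = σ v • z - generator v * contract (1 ⊗ₜ σ) z := by
  induction z using TensorProduct.induction_on with
  | zero => simp
  | add y z hy hz => rw [mul_add, map_add, hy, hz, map_add, mul_add, smul_add]; abel
  | tmul r w =>
    rw [generator_mul_tmul]
    simp only [contract, extendScalars, TensorProduct.AlgebraTensorModule.lift_tmul,
      LinearMap.toSpanSingleton_apply, one_smul, LinearMap.comp_apply, LinearMap.coe_lTensorHom,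
      LinearMap.lTensor_tmul, generator_mul_tmul]
    rw [ExteriorAlgebra.ι, CliffordAlgebra.contractLeft_ι_mul, TensorProduct.tmul_sub,
      TensorProduct.tmul_smul]

variable [FiniteDimensional ℝ V]

theorem ofHom_eq_sum {ι : Type*} [Fintype ι] (b : Module.Basis ι ℝ V) (ξ : V →ₗ[ℝ] Koszul R V) :
    ofHom ξ = ∑ i, ξ (b i) ⊗ₜ b.coord i := by
  rw [ofHom, LinearMap.comp_apply]
  have h : ξ = dualTensorHomEquiv ℝ V (Koszul R V) (∑ i, b.coord i ⊗ₜ ξ (b i)) := by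
    rw [map_sum]
    refine LinearMap.ext fun v => ?_
    conv_lhs => rw [← b.sum_repr v]
    simp [-Module.Basis.sum_repr]
  conv_lhs => rw [h]
  simp

theorem tmul_eq_ofHom (a : Koszul R V) (σ : Module.Dual ℝ V) :
    a ⊗ₜ[ℝ] σ = ofHom (LinearMap.smulRight σ a) := by
  have h : LinearMap.smulRight σ a = dualTensorHomEquiv ℝ V (Koszul R V) (σ ⊗ₜ a) := by
    ext v
    simp
  rw [h, ofHom, LinearMap.comp_apply]
  simp

/-- In a basis, ι_s is the sum of the constant contractions weighted by the components of s. This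
reduces the abstract definition through `ofHom` to the rules for contractions. -/
theorem differential_apply {ι : Type*} [Fintype ι] (b : Module.Basis ι ℝ V) (s : V →ₗ[ℝ] R)
    (z : Koszul R V) :
    differential s z = ∑ i, ofBase (s (b i)) * contract (1 ⊗ₜ b.coord i) z := by
  rw [differential, ofHom_eq_sum b, map_sum, LinearMap.sum_apply]
  exact Finset.sum_congr rfl fun i _ => contract_tmul _ _ _

theorem differential_ofBase (s : V →ₗ[ℝ] R) (f : R) :
    differential s (ofBase f : Koszul R V) = 0 := by
  rw [differential_apply (Module.finBasis ℝ V)]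
  exact Finset.sum_eq_zero fun i _ => by rw [contract_one_tmul_ofBase, mul_zero]

/-- Together with the vanishing on functions this rule characterises the differential; later
arguments use these two rules rather than the definition. -/
theorem differential_generator_mul (s : V →ₗ[ℝ] R) (v : V) (z : Koszul R V) :
    differential s (generator v * z) = ofBase (s v) * z - generator v * differential s z := by
  let b := Module.finBasis ℝ V
  have h : s v = ∑ i, b.coord i v • s (b i) := by
    conv_lhs => rw [← b.sum_repr v]
    simp [-Module.Basis.sum_repr]
  rw [differential_apply b, differential_apply b, h, map_sum, Finset.sum_mul, Finset.mul_sum,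
    ← Finset.sum_sub_distrib]
  refine Finset.sum_congr rfl fun i _ => ?_
  rw [contract_one_tmul_generator_mul, mul_sub, ofBase_left_comm, map_smul, smul_mul_assoc,
    mul_smul_comm]

theorem differential_mem_degree (s : V →ₗ[ℝ] R) {n : ℤ} {z : Koszul R V}
    (hz : z ∈ degree R V n) : differential s z ∈ degree R V (n + 1) := by
  induction hz using degree_induction with
  | zero n => simp
  | add n y z _ _ hy hz => rw [map_add]; exact add_mem hy hz
  | ofBase f => rw [differential_ofBase]; exact zero_mem _
  | generator_mul n v z hz ih =>
    rw [differential_generator_mul, sub_add_cancel]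
    refine sub_mem ?_ ?_
    · simpa using mul_mem_degree (ofBase_mem_degree (s v)) hz
    · simpa using generator_mul_mem_degree v ih

theorem differential_ofBase_mul (s : V →ₗ[ℝ] R) (f : R) (z : Koszul R V) :
    differential s (ofBase f * z) = ofBase f * differential s z := by
  induction z using induction with
  | ofBase g => rw [← map_mul, differential_ofBase, differential_ofBase, mul_zero]
  | generator_mul v z hz =>
    rw [← ofBase_left_comm, differential_generator_mul, differential_generator_mul, hz, mul_sub,
      ofBase_left_comm (f := f) (y := generator v), ofBase_left_comm (f := f)]
  | add y z hy hz => rw [mul_add, map_add, hy, hz, map_add, mul_add]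

/-- The differential is a graded derivation. -/
theorem differential_mul (s : V →ₗ[ℝ] R) {n : ℤ} {y : Koszul R V}
    (hy : y ∈ degree R V n) (z : Koszul R V) :
    differential s (y * z) = differential s y * z + (-1 : ℝ) ^ n • (y * differential s z) := by
  induction hy using degree_induction with
  | zero n => simp
  | add n x y _ _ hx hy => rw [add_mul, map_add, hx, hy, map_add, add_mul, add_mul, smul_add]; abel
  | ofBase f => rw [differential_ofBase_mul, differential_ofBase, zpow_zero]; simp
  | generator_mul n v y hy ih =>
    rw [mul_assoc, differential_generator_mul, ih, differential_generator_mul, sub_mul, mul_add,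
      neg_one_zpow_sub_one, mul_smul_comm, neg_smul, mul_assoc, mul_assoc, mul_assoc]
    abel

theorem differential_differential (s : V →ₗ[ℝ] R) (z : Koszul R V) :
    differential s (differential s z) = 0 := by
  induction z using induction with
  | ofBase f => rw [differential_ofBase, map_zero]
  | generator_mul v z hz =>
    -- The two copies of s(v) δz cancel, and the remaining term contains δδz, which is zero by
    -- induction.
    rw [differential_generator_mul, map_sub, differential_ofBase_mul, differential_generator_mul,
      hz]
    simp
  | add y z hy hz => rw [map_add, map_add, hy, hz, add_zero]

end Koszul

end KoszulAlgebra

/-! ### The grading of a free module `A ⊗ V` -/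

section ActionAlgebroid

variable {A : Type*} [Ring A] [Algebra ℝ A]

theorem extendScalars_tmul {W P : Type*} [AddCommGroup W] [Module ℝ W] [AddCommGroup P]
    [Module ℝ P] [Module A P] [IsScalarTower ℝ A P] [SMulCommClass ℝ A P] (f : W →ₗ[ℝ] P)
    (a : A) (w : W) : extendScalars f (a ⊗ₜ[ℝ] w) = a • f w := by
  simp [extendScalars]

variable {V : Type*} [AddCommGroup V] [Module ℝ V]

/-- The homogeneous part of degree `n` of `A ⊗ V`, for `V` in degree `0`. -/
def tensorDegree (V : Type*) [AddCommGroup V] [Module ℝ V] (𝓐 : ℤ → Submodule ℝ A) (n : ℤ) :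
    Submodule ℝ (A ⊗[ℝ] V) :=
  LinearMap.range (LinearMap.rTensor V (𝓐 n).subtype)

theorem tmul_mem_tensorDegree {𝓐 : ℤ → Submodule ℝ A} {n : ℤ} {a : A} (ha : a ∈ 𝓐 n) (v : V) :
    a ⊗ₜ v ∈ tensorDegree V 𝓐 n :=
  ⟨⟨a, ha⟩ ⊗ₜ v, rfl⟩

theorem tensorDegree_induction {𝓐 : ℤ → Submodule ℝ A} {n : ℤ} {p : A ⊗[ℝ] V → Prop}
    (zero : p 0) (add : ∀ x y, p x → p y → p (x + y)) (tmul : ∀ a ∈ 𝓐 n, ∀ v, p (a ⊗ₜ v))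
    {x : A ⊗[ℝ] V} (hx : x ∈ tensorDegree V 𝓐 n) : p x := by
  obtain ⟨y, rfl⟩ := hx
  induction y using TensorProduct.induction_on with
  | zero => rwa [map_zero]
  | add x y hx hy => rw [map_add]; exact add _ _ hx hy
  | tmul a v => exact tmul a.1 a.2 v

end ActionAlgebroid

/-! ### The dg-Lie algebroid of a Lie algebra action -/

section ActionAlgebroid

variable {A : Type*} [Ring A] [Algebra ℝ A] {V : Type*} [LieRing V] [LieAlgebra ℝ V]

/-- The bracket on `A ⊗ V` extending `-⁅X, Y⁆` for the anchor extending `D : V → End A`. -/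
def actionBracket (D : V →ₗ[ℝ] Module.End ℝ A) : A ⊗[ℝ] V →ₗ[ℝ] A ⊗[ℝ] V →ₗ[ℝ] A ⊗[ℝ] V :=
  TensorProduct.lift (LinearMap.mk₂ ℝ
    (fun a X => TensorProduct.lift (LinearMap.mk₂ ℝ
      -- The formula is forced by the Leibniz rule in both arguments. The Koszul sign from moving b
      -- past D_Y a disappears when the product is kept in the order D_Y a · b, so the bracket can
      -- be defined without mentioning the grading.
      (fun b Y => (a * D X b) ⊗ₜ[ℝ] Y - (D Y a * b) ⊗ₜ[ℝ] X - (a * b) ⊗ₜ[ℝ] ⁅X, Y⁆)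
      (fun b b' Y => by simp only [map_add, mul_add, TensorProduct.add_tmul]; abel)
      (fun c b Y => by
        simp only [map_smul, mul_smul_comm, TensorProduct.smul_tmul', smul_sub])
      (fun b Y Y' => by
        simp only [map_add, LinearMap.add_apply, add_mul, TensorProduct.add_tmul,
          TensorProduct.tmul_add, lie_add]
        abel)
      (fun c b Y => by
        simp only [map_smul, LinearMap.smul_apply, smul_mul_assoc, TensorProduct.tmul_smul,
          TensorProduct.smul_tmul', smul_sub, lie_smul])))
    (fun a a' X => by
      refine TensorProduct.ext' fun b Y => ?_
      simp only [map_add, add_mul, TensorProduct.add_tmul, LinearMap.add_apply,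
        TensorProduct.lift.tmul, LinearMap.mk₂_apply]
      abel)
    (fun c a X => by
      refine TensorProduct.ext' fun b Y => ?_
      simp only [map_smul, smul_mul_assoc, TensorProduct.smul_tmul', LinearMap.smul_apply,
        TensorProduct.lift.tmul, LinearMap.mk₂_apply, smul_sub])
    (fun a X X' => by
      refine TensorProduct.ext' fun b Y => ?_
      simp only [map_add, mul_add, TensorProduct.add_tmul, TensorProduct.tmul_add,
        LinearMap.add_apply, TensorProduct.lift.tmul, LinearMap.mk₂_apply, add_lie]
      abel)
    (fun c a X => by
      refine TensorProduct.ext' fun b Y => ?_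
      simp only [map_smul, mul_smul_comm, TensorProduct.smul_tmul', TensorProduct.tmul_smul,
        LinearMap.smul_apply, TensorProduct.lift.tmul, LinearMap.mk₂_apply, smul_sub, smul_lie]))

theorem actionBracket_tmul (D : V →ₗ[ℝ] Module.End ℝ A) (a b : A) (X Y : V) :
    actionBracket D (a ⊗ₜ X) (b ⊗ₜ Y) =
      (a * D X b) ⊗ₜ[ℝ] Y - (D Y a * b) ⊗ₜ[ℝ] X - (a * b) ⊗ₜ[ℝ] ⁅X, Y⁆ := by
  simp [actionBracket]

variable {𝓐 : ℤ → Submodule ℝ A} {δ : A →ₗ[ℝ] A} {D : V →ₗ[ℝ] Module.End ℝ A}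
  {𝓣 : ℤ → Submodule ℝ (Module.End ℝ A)} {ρ : A ⊗[ℝ] V →ₗ[A] Module.End ℝ A}

theorem neg_one_zpow_smul_smul {W : Type*} [AddCommGroup W] [Module ℝ W] (n : ℤ) (w : W) :
    (-1 : ℝ) ^ n • (-1 : ℝ) ^ n • w = w := by
  rw [smul_smul, Koszul.neg_one_zpow_mul_self, one_smul]

/-- A Lie algebra acting on a graded-commutative dg-algebra `A` by derivations of degree `0` that
commute with the differential makes `A ⊗ V` a dg-Lie algebroid. -/
theorem isDGLieAlgebroid_actionBracket
    (mul_mem : ∀ m n, ∀ a ∈ 𝓐 m, ∀ b ∈ 𝓐 n, a * b ∈ 𝓐 (m + n))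
    (mul_comm : ∀ m n, ∀ a ∈ 𝓐 m, ∀ b ∈ 𝓐 n, a * b = (-1 : ℝ) ^ (m * n) • (b * a))
    (δ_mem : ∀ n, ∀ a ∈ 𝓐 n, δ a ∈ 𝓐 (n + 1)) (δ_δ : ∀ a, δ (δ a) = 0)
    (δ_mul : ∀ n, ∀ a ∈ 𝓐 n, ∀ b, δ (a * b) = δ a * b + (-1 : ℝ) ^ n • (a * δ b))
    (D_mem : ∀ X n, ∀ a ∈ 𝓐 n, D X a ∈ 𝓐 n)
    (D_mul : ∀ X a b, D X (a * b) = D X a * b + a * D X b)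
    (D_lie : ∀ X Y a, D ⁅X, Y⁆ a = D Y (D X a) - D X (D Y a))
    (D_δ : ∀ X a, D X (δ a) = δ (D X a))
    (ρ_tmul : ∀ a X, ρ (a ⊗ₜ X) = a • D X)
    (ρ_mem : ∀ n, ∀ x ∈ tensorDegree V 𝓐 n, ρ x ∈ 𝓣 n) :
    IsDGLieAlgebroid 𝓐 δ 𝓣 (tensorDegree V 𝓐) (LinearMap.rTensor V δ) ρ (actionBracket D) where
  smul_mem m n a ha x hx := by
    refine tensorDegree_induction (p := fun x => a • x ∈ _) (by simp)
      (fun x y hx hy => by rw [smul_add]; exact add_mem hx hy) (fun b hb v => ?_) hx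
    exact tmul_mem_tensorDegree (mul_mem _ _ a ha b hb) v
  diff_mem n x hx := by
    refine tensorDegree_induction (p := fun x => LinearMap.rTensor V δ x ∈ _) (by simp)
      (fun x y hx hy => by rw [map_add]; exact add_mem hx hy) (fun b hb v => ?_) hx
    exact tmul_mem_tensorDegree (δ_mem _ b hb) v
  diff_diff x := by
    rw [← LinearMap.comp_apply, ← LinearMap.rTensor_comp,
      show δ ∘ₗ δ = 0 from LinearMap.ext δ_δ, LinearMap.rTensor_zero, LinearMap.zero_apply]
  diff_smul m a ha x := by
    induction x using TensorProduct.induction_on with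
    | zero => simp
    | add x y hx hy => simp only [smul_add, map_add, hx, hy]; abel
    | tmul b v =>
      simp only [TensorProduct.smul_tmul', smul_eq_mul, LinearMap.rTensor_tmul, δ_mul m a ha b,
        TensorProduct.add_tmul]
  lie_mem m n x hx y hy := by
    refine tensorDegree_induction (p := fun x => actionBracket D x y ∈ _) (by simp)
      (fun x y hx hy => by rw [map_add]; exact add_mem hx hy) (fun a ha X => ?_) hx
    refine tensorDegree_induction (p := fun y => actionBracket D (a ⊗ₜ X) y ∈ _) (by simp)
      (fun x y hx hy => by rw [map_add]; exact add_mem hx hy) (fun b hb Y => ?_) hy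
    rw [actionBracket_tmul]
    exact sub_mem (sub_mem (tmul_mem_tensorDegree (mul_mem _ _ _ ha _ (D_mem _ _ _ hb)) _)
      (tmul_mem_tensorDegree (mul_mem _ _ _ (D_mem _ _ _ ha) _ hb) _))
      (tmul_mem_tensorDegree (mul_mem _ _ _ ha _ hb) _)
  lie_skew m n x hx y hy := by
    refine tensorDegree_induction
      (p := fun x => actionBracket D x y = -((-1 : ℝ) ^ (m * n) • actionBracket D y x)) (by simp)
      (fun x y hx hy => by
        rw [map_add, LinearMap.add_apply, hx, hy, map_add, smul_add, neg_add])
      (fun a ha X => ?_) hx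
    refine tensorDegree_induction (p := fun y => actionBracket D (a ⊗ₜ X) y =
        -((-1 : ℝ) ^ (m * n) • actionBracket D y (a ⊗ₜ X))) (by simp)
      (fun x y hx hy => by
        rw [map_add, hx, hy, map_add, LinearMap.add_apply, smul_add, neg_add])
      (fun b hb Y => ?_) hy
    rw [actionBracket_tmul, actionBracket_tmul, mul_comm _ _ _ ha _ (D_mem X _ _ hb),
      mul_comm _ _ _ (D_mem Y _ _ ha) _ hb, mul_comm _ _ _ ha _ hb, ← lie_skew X Y]
    simp only [TensorProduct.tmul_neg, TensorProduct.smul_tmul', smul_sub]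
    abel
  jacobi m n x hx y hy z := by
    refine tensorDegree_induction (p := fun x => actionBracket D x (actionBracket D y z) =
      actionBracket D (actionBracket D x y) z +
        (-1 : ℝ) ^ (m * n) • actionBracket D y (actionBracket D x z)) (by simp)
      (fun x y hx hy => by simp only [map_add, LinearMap.add_apply, hx, hy, smul_add]; abel)
      (fun a ha X => ?_) hx
    refine tensorDegree_induction (p := fun y =>
      actionBracket D (a ⊗ₜ X) (actionBracket D y z) =
      actionBracket D (actionBracket D (a ⊗ₜ X) y) z +
        (-1 : ℝ) ^ (m * n) • actionBracket D y (actionBracket D (a ⊗ₜ X) z)) (by simp)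
      (fun x y hx hy => by simp only [map_add, LinearMap.add_apply, hx, hy, smul_add]; abel)
      (fun b hb Y => ?_) hy
    induction z using TensorProduct.induction_on with
    | zero => simp
    | add x y hx hy => simp only [map_add, hx, hy, smul_add]; abel
    | tmul e Z =>
      -- Every monomial is brought to the order a, b, e; each exchange produces the sign of the
      -- Jacobi identity, and two such signs cancel. No homogeneity of e is needed.
      have swap : ∀ a' ∈ 𝓐 m, ∀ b' ∈ 𝓐 n, ∀ w,
          b' * (a' * w) = (-1 : ℝ) ^ (m * n) • (a' * (b' * w)) := fun a' ha' b' hb' w => by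
        rw [← mul_assoc, mul_comm _ _ _ hb' _ ha', Int.mul_comm, smul_mul_assoc, mul_assoc]
      simp only [actionBracket_tmul, map_sub, LinearMap.sub_apply, D_mul, D_lie, mul_add, add_mul,
        sub_mul, mul_sub, mul_assoc, smul_sub, TensorProduct.add_tmul, TensorProduct.sub_tmul,
        swap _ ha _ hb, swap _ (D_mem _ _ _ ha) _ hb, swap _ ha _ (D_mem _ _ _ hb),
        swap _ (D_mem _ _ _ ha) _ (D_mem _ _ _ hb),
        swap _ (D_mem _ _ _ (D_mem _ _ _ ha)) _ hb,
        swap _ ha _ (D_mem _ _ _ (D_mem _ _ _ hb)),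
        TensorProduct.smul_tmul', smul_add, neg_one_zpow_smul_smul]
      -- After the coefficients are normalised, the undifferentiated terms cancel by the Jacobi
      -- identity of V; the others cancel in pairs, up to skew symmetry.
      rw [leibniz_lie X Y Z, TensorProduct.tmul_add]
      rw [← lie_skew X Y]
      simp only [TensorProduct.tmul_neg]
      abel
  diff_lie m x hx y := by
    refine tensorDegree_induction (p := fun x => LinearMap.rTensor V δ (actionBracket D x y) =
      actionBracket D (LinearMap.rTensor V δ x) y +
        (-1 : ℝ) ^ m • actionBracket D x (LinearMap.rTensor V δ y)) (by simp)
      (fun x y hx hy => by simp only [map_add, LinearMap.add_apply, hx, hy, smul_add]; abel)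
      (fun a ha X => ?_) hx
    induction y using TensorProduct.induction_on with
    | zero => simp
    | add x y hx hy => simp only [map_add, hx, hy, smul_add]; abel
    | tmul b Y =>
      simp only [actionBracket_tmul, map_sub, LinearMap.rTensor_tmul, δ_mul _ _ ha,
        δ_mul _ _ (D_mem _ _ _ ha), D_δ, TensorProduct.add_tmul, smul_sub,
        TensorProduct.smul_tmul']
      abel
  anchor_mem := ρ_mem
  anchor_diff n x hx := by
    refine tensorDegree_induction
      (p := fun x => ρ (LinearMap.rTensor V δ x) = homDifferential δ δ n (ρ x))
      (by simp [homDifferential])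
      (fun x y hx hy => by
        simp only [map_add, hx, hy, homDifferential, LinearMap.comp_add, LinearMap.add_comp,
          smul_add]
        abel)
      (fun a ha X => ?_) hx
    ext z
    simp [ρ_tmul, homDifferential, δ_mul _ _ ha, D_δ]
  anchor_lie m n x hx y hy := by
    refine tensorDegree_induction (p := fun x => ρ (actionBracket D x y) =
        ρ x ∘ₗ ρ y - (-1 : ℝ) ^ (m * n) • (ρ y ∘ₗ ρ x)) (by simp)
      (fun x y hx hy => by
        simp only [map_add, LinearMap.add_apply, hx, hy, LinearMap.comp_add, LinearMap.add_comp,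
          smul_add]
        abel)
      (fun a ha X => ?_) hx
    refine tensorDegree_induction (p := fun y => ρ (actionBracket D (a ⊗ₜ X) y) =
        ρ (a ⊗ₜ X) ∘ₗ ρ y - (-1 : ℝ) ^ (m * n) • (ρ y ∘ₗ ρ (a ⊗ₜ X))) (by simp)
      (fun x y hx hy => by
        simp only [map_add, hx, hy, LinearMap.comp_add, LinearMap.add_comp, smul_add]
        abel)
      (fun b hb Y => ?_) hy
    ext z
    have swap : ∀ a' ∈ 𝓐 m, ∀ w, b * (a' * w) = (-1 : ℝ) ^ (m * n) • (a' * (b * w)) :=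
      fun a' ha' w => by
        rw [← mul_assoc, mul_comm _ _ _ hb _ ha', Int.mul_comm, smul_mul_assoc, mul_assoc]
    simp only [actionBracket_tmul, map_sub, ρ_tmul, LinearMap.sub_apply, LinearMap.smul_apply,
      LinearMap.comp_apply, smul_eq_mul, D_mul, D_lie, mul_add, mul_sub, mul_assoc, smul_add,
      swap _ ha, swap _ (D_mem _ _ _ ha), neg_one_zpow_smul_smul]
    abel
  lie_smul m k x hx a ha y := by
    refine tensorDegree_induction (p := fun x => actionBracket D x (a • y) =
        (-1 : ℝ) ^ (m * k) • (a • actionBracket D x y) + ρ x a • y) (by simp)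
      (fun x y hx hy => by
        simp only [map_add, LinearMap.add_apply, hx, hy, smul_add, add_smul]
        abel)
      (fun b hb X => ?_) hx
    induction y using TensorProduct.induction_on with
    | zero => simp
    | add x y hx hy => simp only [map_add, hx, hy, smul_add]; abel
    | tmul e Y =>
      have swap : ∀ b' ∈ 𝓐 m, ∀ w, a * (b' * w) = (-1 : ℝ) ^ (m * k) • (b' * (a * w)) :=
        fun b' hb' w => by
          rw [← mul_assoc, mul_comm _ _ _ ha _ hb', Int.mul_comm, smul_mul_assoc, mul_assoc]
      simp only [TensorProduct.smul_tmul', smul_eq_mul, actionBracket_tmul, ρ_tmul,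
        LinearMap.smul_apply, smul_sub, mul_assoc, D_mul, mul_add, TensorProduct.add_tmul,
        swap _ hb, swap _ (D_mem _ _ _ hb), neg_one_zpow_smul_smul]
      abel

end ActionAlgebroid

/-! ### Derivatives of vector-valued maps on manifolds -/

section Calculus

variable {E₁ : Type*} [NormedAddCommGroup E₁] [NormedSpace ℝ E₁]
  {N : Type*} [TopologicalSpace N] [ChartedSpace E₁ N]
  {E₂ : Type*} [NormedAddCommGroup E₂] [NormedSpace ℝ E₂]
  {Q : Type*} [TopologicalSpace Q] [ChartedSpace E₂ Q]
  {V : Type*} [NormedAddCommGroup V] [NormedSpace ℝ V]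

variable (E₁) in
/-- The derivative of a map from a manifold to a vector space. -/
def derivAt (f : N → V) (x : N) : E₁ →L[ℝ] V := mfderiv 𝓘(ℝ, E₁) 𝓘(ℝ, V) f x

/-- The model has no boundary and the target is a vector space, so the manifold derivative is an
ordinary derivative in one chart. This makes product rules and symmetry of second derivatives
available. -/
theorem derivAt_eq_fderiv {f : N → V} {x : N} (hf : MDifferentiableAt 𝓘(ℝ, E₁) 𝓘(ℝ, V) f x) :
    derivAt E₁ f x = fderiv ℝ (f ∘ (chartAt E₁ x).symm) (chartAt E₁ x x) := by
  rw [← fderivWithin_univ, ← ModelWithCorners.range_eq_univ 𝓘(ℝ, E₁)]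
  unfold derivAt mfderiv
  exact if_pos hf

theorem contMDiffAt_chart_symm [IsManifold 𝓘(ℝ, E₁) ∞ N] (x : N) :
    ContMDiffAt 𝓘(ℝ, E₁) 𝓘(ℝ, E₁) ∞ (chartAt E₁ x).symm (chartAt E₁ x x) :=
  contMDiffOn_chart_symm.contMDiffAt
    ((chartAt E₁ x).open_target.mem_nhds (mem_chart_target E₁ x))

theorem contDiffAt_comp_chart_symm [IsManifold 𝓘(ℝ, E₁) ∞ N] {f : N → V} {x : N}
    (hf : ContMDiff 𝓘(ℝ, E₁) 𝓘(ℝ, V) ∞ f) :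
    ContDiffAt ℝ ∞ (f ∘ (chartAt E₁ x).symm) (chartAt E₁ x x) := by
  rw [← contMDiffAt_iff_contDiffAt]
  exact hf.contMDiffAt.comp _ (contMDiffAt_chart_symm x)

theorem derivAt_clm_comp_apply [IsManifold 𝓘(ℝ, E₁) ∞ N] {V' V'' : Type*}
    [NormedAddCommGroup V'] [NormedSpace ℝ V'] [NormedAddCommGroup V''] [NormedSpace ℝ V'']
    {f : N → V' →L[ℝ] V''} {g : N → V →L[ℝ] V'} {x : N}
    (hf : ContMDiff 𝓘(ℝ, E₁) 𝓘(ℝ, V' →L[ℝ] V'') ∞ f) (hg : ContMDiff 𝓘(ℝ, E₁) 𝓘(ℝ, V →L[ℝ] V') ∞ g)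
    (X : E₁) (Y : V) :
    derivAt E₁ (fun y => (f y).comp (g y)) x X Y =
      derivAt E₁ f x X (g x Y) + f x (derivAt E₁ g x X Y) := by
  have h0 : (∞ : WithTop ℕ∞) ≠ 0 := by simp
  rw [derivAt_eq_fderiv ((hf.clm_comp hg).mdifferentiable h0 x),
    derivAt_eq_fderiv (hf.mdifferentiable h0 x),
    derivAt_eq_fderiv (hg.mdifferentiable h0 x)]
  have h1 := ((contDiffAt_comp_chart_symm (x := x) hf).differentiableAt h0).hasFDerivAt
  have h2 := ((contDiffAt_comp_chart_symm (x := x) hg).differentiableAt h0).hasFDerivAt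
  have h3 := (h1.clm_comp h2).fderiv
  have e : (fun y => (f y).comp (g y)) ∘ (chartAt E₁ x).symm = fun y =>
    ((f ∘ (chartAt E₁ x).symm) y).comp ((g ∘ (chartAt E₁ x).symm) y) := rfl
  rw [e, h3]
  simp [add_comm]

/-- Smoothness of a derivative with parameters holds a priori in tangent coordinates. The base point
q₀ is fixed and the target is a vector space, so both coordinate changes are the identity. -/
theorem contMDiff_derivAt_right [IsManifold 𝓘(ℝ, E₁) ∞ N] [IsManifold 𝓘(ℝ, E₂) ∞ Q] {ψ : N × Q → V}
    (hψ : ContMDiff (𝓘(ℝ, E₁).prod 𝓘(ℝ, E₂)) 𝓘(ℝ, V) ∞ ψ) (q₀ : Q) :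
    ContMDiff 𝓘(ℝ, E₁) 𝓘(ℝ, E₂ →L[ℝ] V) ∞
      (fun n => derivAt E₂ (fun q => ψ (n, q)) q₀) := by
  intro n₀
  have h := ContMDiffAt.mfderiv (m := ∞) (n := ∞) (x₀ := n₀) (fun n q => ψ (n, q))
    (fun _ => q₀) hψ.contMDiffAt contMDiffAt_const (by simp)
  refine h.congr_of_eventuallyEq (Filter.Eventually.of_forall fun n => ?_)
  have h1 := inTangentCoordinates_eq (I := 𝓘(ℝ, E₂)) (I' := 𝓘(ℝ, V)) (fun _ : N => q₀)
    (fun n : N => ψ (n, q₀)) (fun n => derivAt E₂ (fun q => ψ (n, q)) q₀) (x₀ := n₀) (x := n)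
    (mem_chart_source E₂ _) (Set.mem_univ _)
  change derivAt E₂ (fun q => ψ (n, q)) q₀ = inTangentCoordinates 𝓘(ℝ, E₂) 𝓘(ℝ, V)
    (fun _ : N => q₀) (fun n : N => ψ (n, q₀)) (fun n => derivAt E₂ (fun q => ψ (n, q)) q₀) n₀ n
  rw [h1]
  ext v
  simp only [ContinuousLinearMap.comp_apply]
  rw [(tangentBundleCore 𝓘(ℝ, E₂) Q).coordChange_self _ _ (mem_chart_source E₂ _)]
  exact ((tangentBundleCore 𝓘(ℝ, V) V).coordChange_self _ _ (mem_chart_source V _) _).symm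

/-- Symmetry of the second derivative for the map read in a product of charts, applied to one vector
along each factor. -/
theorem derivAt_derivAt_comm [IsManifold 𝓘(ℝ, E₁) ∞ N] [IsManifold 𝓘(ℝ, E₂) ∞ Q] {ψ : N × Q → V}
    (hψ : ContMDiff (𝓘(ℝ, E₁).prod 𝓘(ℝ, E₂)) 𝓘(ℝ, V) ∞ ψ) (n₀ : N) (q₀ : Q) (X : E₁) (Y : E₂) :
    derivAt E₁ (fun n => derivAt E₂ (fun q => ψ (n, q)) q₀) n₀ X Y =
      derivAt E₂ (fun q => derivAt E₁ (fun n => ψ (n, q)) n₀) q₀ Y X := by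
  have h0 : (∞ : WithTop ℕ∞) ≠ 0 := by simp
  have hψ' : ContMDiff (𝓘(ℝ, E₂).prod 𝓘(ℝ, E₁)) 𝓘(ℝ, V) ∞ (fun p : Q × N => ψ (p.2, p.1)) :=
    hψ.comp (contMDiff_snd.prodMk contMDiff_fst)
  have hq (n : N) : ContMDiff 𝓘(ℝ, E₂) 𝓘(ℝ, V) ∞ (fun q => ψ (n, q)) :=
    hψ.comp (contMDiff_const.prodMk contMDiff_id)
  have hn (q : Q) : ContMDiff 𝓘(ℝ, E₁) 𝓘(ℝ, V) ∞ (fun n => ψ (n, q)) :=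
    hψ.comp (contMDiff_id.prodMk contMDiff_const)
  rw [derivAt_eq_fderiv ((contMDiff_derivAt_right hψ q₀).mdifferentiable h0 n₀),
    derivAt_eq_fderiv ((contMDiff_derivAt_right hψ' n₀).mdifferentiable h0 q₀)]
  let x₀ := chartAt E₁ n₀ n₀
  let y₀ := chartAt E₂ q₀ q₀
  let f : E₁ × E₂ → V := fun p => ψ ((chartAt E₁ n₀).symm p.1, (chartAt E₂ q₀).symm p.2)
  have hf : ContDiffAt ℝ ∞ f (x₀, y₀) := by
    have h : ContMDiffAt (𝓘(ℝ, E₁).prod 𝓘(ℝ, E₂)) 𝓘(ℝ, V) ∞ f (x₀, y₀) :=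
      hψ.contMDiffAt.comp (x₀, y₀)
        ((contMDiffAt_chart_symm n₀).prodMap (contMDiffAt_chart_symm q₀))
    rw [← contMDiffAt_iff_contDiffAt, modelWithCornersSelf_prod, ← chartedSpaceSelf_prod]
    exact h
  have hd : ∀ᶠ p in nhds (x₀, y₀), DifferentiableAt ℝ f p := by
    filter_upwards [(hf.of_le (m := 1) (by simp)).eventually (by simp)] with p hp using hp.differentiableAt one_ne_zero
  have hf' := ((hf.fderiv_right (m := 1) (by norm_cast)).differentiableAt one_ne_zero).hasFDerivAt
  -- The partial derivative is the total one restricted to a factor only where `f` is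
  -- differentiable, which is known near the base point. A germ is enough to differentiate once
  -- more.
  have e₁ : ((fun n => derivAt E₂ (fun q => ψ (n, q)) q₀) ∘
      (chartAt E₁ n₀).symm) =ᶠ[nhds x₀]
      fun x => (fderiv ℝ f (x, y₀)).comp (ContinuousLinearMap.inr ℝ E₁ E₂) := by
    have hc : Filter.Tendsto (fun x : E₁ => (x, y₀)) (nhds x₀) (nhds (x₀, y₀)) :=
      (Continuous.prodMk_left y₀).continuousAt
    filter_upwards [hc.eventually hd] with x hx
    simp only [Function.comp_apply]
    rw [derivAt_eq_fderiv ((hq _).mdifferentiable h0 _)]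
    exact (hx.hasFDerivAt.comp y₀ (hasFDerivAt_prodMk_right x y₀)).fderiv
  have e₂ : ((fun q => derivAt E₁ (fun n => ψ (n, q)) n₀) ∘
      (chartAt E₂ q₀).symm) =ᶠ[nhds y₀]
      fun y => (fderiv ℝ f (x₀, y)).comp (ContinuousLinearMap.inl ℝ E₁ E₂) := by
    have hc : Filter.Tendsto (fun y : E₂ => (x₀, y)) (nhds y₀) (nhds (x₀, y₀)) :=
      (Continuous.prodMk_right x₀).continuousAt
    filter_upwards [hc.eventually hd] with y hy
    simp only [Function.comp_apply]
    rw [derivAt_eq_fderiv ((hn _).mdifferentiable h0 _)]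
    exact (HasFDerivAt.comp (f := fun e => (e, y)) x₀ hy.hasFDerivAt
      (hasFDerivAt_prodMk_left x₀ y)).fderiv
  have d₁ := ((hf'.comp x₀ (hasFDerivAt_prodMk_left x₀ y₀)).clm_comp
    (hasFDerivAt_const (ContinuousLinearMap.inr ℝ E₁ E₂) x₀)).congr_of_eventuallyEq e₁
  have d₂ := ((hf'.comp y₀ (hasFDerivAt_prodMk_right x₀ y₀)).clm_comp
    (hasFDerivAt_const (ContinuousLinearMap.inl ℝ E₁ E₂) y₀)).congr_of_eventuallyEq e₂
  have hs := hf.isSymmSndFDerivAt (by simpa using (WithTop.coe_le_coe (b := (2 : ℕ∞)) (a := ⊤)).2 le_top) (X, 0) (0, Y)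
  rw [d₁.fderiv, d₂.fderiv]
  simpa using hs

end Calculus

/-! ### The derivative of Ad and the Lie bracket -/

section LieGroupCalculus

set_option linter.unusedSectionVars false

variable {F : Type*} [NormedAddCommGroup F] [NormedSpace ℝ F] [FiniteDimensional ℝ F]
  {G : Type*} [TopologicalSpace G] [ChartedSpace F G] [Group G] [LieGroup 𝓘(ℝ, F) ∞ G]
  {V : Type*} [NormedAddCommGroup V] [NormedSpace ℝ V]

theorem infty_ne_zero : (∞ : WithTop ℕ∞) ≠ 0 := by simp

variable (F) in
/-- The derivative `d φ_g ∘ d (L_g)_1` of `φ` at `g`, in the left trivialization. -/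
def leftDeriv (φ : G → V) (g : G) : F →L[ℝ] V := derivAt F (fun k => φ (g * k)) 1

theorem contMDiff_leftDeriv {φ : G → V} (hφ : ContMDiff 𝓘(ℝ, F) 𝓘(ℝ, V) ∞ φ) :
    ContMDiff 𝓘(ℝ, F) 𝓘(ℝ, F →L[ℝ] V) ∞ (leftDeriv F φ) :=
  contMDiff_derivAt_right (ψ := fun p : G × G => φ (p.1 * p.2))
    (hφ.comp (contMDiff_fst.mul contMDiff_snd)) 1

theorem leftDeriv_one (φ : G → V) : leftDeriv F φ 1 = derivAt F φ 1 := by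
  simp [leftDeriv]

theorem leftDeriv_apply {φ : G → V} (hφ : ContMDiff 𝓘(ℝ, F) 𝓘(ℝ, V) ∞ φ) (g : G) (X : LieAlg F G) :
    leftDeriv F φ g X = derivAt F φ g (mulInvariantVectorField X g) := by
  have h := mfderiv_comp (I := 𝓘(ℝ, F)) (I' := 𝓘(ℝ, F)) (I'' := 𝓘(ℝ, V)) (g := φ)
    (f := fun k : G => g * k) 1 (hφ.mdifferentiable infty_ne_zero _)
    ((contMDiff_mul_left (I := 𝓘(ℝ, F)) (n := ∞) (a := g)).mdifferentiable infty_ne_zero 1)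
  have h2 := congrArg (fun L => L X) h
  -- The chain rule produces the derivative at `g * 1`; the point is generalised because tangent
  -- spaces at propositionally equal points are different types.
  have h3 : ∀ a : G, a = g → mfderiv 𝓘(ℝ, F) 𝓘(ℝ, V) φ a
    (mfderiv 𝓘(ℝ, F) 𝓘(ℝ, F) (fun k : G => g * k) 1 X : F) =
      derivAt F φ g (mulInvariantVectorField X g) := by
    rintro a rfl
    rfl
  exact h2.trans (h3 _ (mul_one g))

/-- From k g = g (g⁻¹ k g): right translation by g is left translation after conjugation by g⁻¹. -/
theorem derivAt_mul_right {φ : G → V} (hφ : ContMDiff 𝓘(ℝ, F) 𝓘(ℝ, V) ∞ φ) (g : G) :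
    derivAt F (fun k => φ (k * g)) 1 = (leftDeriv F φ g).comp (adjoint g⁻¹) := by
  have e : (fun k => φ (k * g)) = (fun k => φ (g * k)) ∘ fun k => g⁻¹ * k * g⁻¹⁻¹ := by
    ext k
    simp [mul_assoc]
  have h1 : ContMDiff 𝓘(ℝ, F) 𝓘(ℝ, V) ∞ (fun k => φ (g * k)) := hφ.comp contMDiff_mul_left
  have h2 : ContMDiff 𝓘(ℝ, F) 𝓘(ℝ, F) ∞ (fun k : G => g⁻¹ * k * g⁻¹⁻¹) :=
    contMDiff_mul_right.comp contMDiff_mul_left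
  have h := mfderiv_comp (I := 𝓘(ℝ, F)) (I' := 𝓘(ℝ, F)) (I'' := 𝓘(ℝ, V)) (g := fun k => φ (g * k))
    (f := fun k : G => g⁻¹ * k * g⁻¹⁻¹) 1 (h1.mdifferentiable infty_ne_zero _)
    (h2.mdifferentiable infty_ne_zero _)
  rw [e]
  have h3 : ∀ a : G, a = 1 → (derivAt F (fun k => φ (g * k)) a).comp (adjoint g⁻¹) =
      (leftDeriv F φ g).comp (adjoint g⁻¹) := by
    rintro a rfl
    rfl
  exact Eq.trans h (h3 _ (by simp))

/-- Left and right multiplication derivatives commute. -/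
theorem derivAt_derivAt_mul_right {φ : G → V} (hφ : ContMDiff 𝓘(ℝ, F) 𝓘(ℝ, V) ∞ φ) (X Y : F) :
    derivAt F (fun g => derivAt F (fun k => φ (k * g)) 1) (1 : G) Y X =
      derivAt F (leftDeriv F φ) 1 X Y :=
  derivAt_derivAt_comm (ψ := fun p : G × G => φ (p.2 * p.1))
    (hφ.comp (contMDiff_snd.mul contMDiff_fst)) 1 1 Y X

theorem adjoint_one : adjoint (1 : G) = ContinuousLinearMap.id ℝ F := by
  have e : (fun h : G => 1 * h * 1⁻¹) = id := by
    ext h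
    simp
  have h : ∀ f : G → G, f = id →
      @Eq (F →L[ℝ] F) (mfderiv 𝓘(ℝ, F) 𝓘(ℝ, F) f 1) (ContinuousLinearMap.id ℝ F) := by
    rintro f rfl
    exact mfderiv_id
  exact h _ e

theorem contMDiff_adjoint_inv :
    ContMDiff 𝓘(ℝ, F) 𝓘(ℝ, F →L[ℝ] F) ∞ (fun g : G => (adjoint g⁻¹ : F →L[ℝ] F)) :=
  contMDiff_adjoint.comp (contMDiff_inv 𝓘(ℝ, F) ∞)

/-- Differentiate `derivAt_mul_right` in g at 1 along X. Left and right translations commute, so the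
left side is the second derivative with its arguments exchanged, while the product rule on the right
adds the derivative of Ad. -/
theorem derivAt_leftDeriv_sub {φ : G → V} (hφ : ContMDiff 𝓘(ℝ, F) 𝓘(ℝ, V) ∞ φ) (X Y : F) :
    derivAt F (leftDeriv F φ) 1 Y X - derivAt F (leftDeriv F φ) 1 X Y =
      derivAt F φ 1 (derivAt F (fun g : G => (adjoint g⁻¹ : F →L[ℝ] F)) 1 X Y) := by
  have h := derivAt_clm_comp_apply (x := 1) (contMDiff_leftDeriv hφ) contMDiff_adjoint_inv X Y
  simp only [← derivAt_mul_right hφ] at h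
  rw [derivAt_derivAt_mul_right hφ, inv_one, adjoint_one, leftDeriv_one] at h
  rw [h]
  simp

/-- The free constant c admits both a cut-off chart and a chart normalised to vanish at 1. -/
theorem derivAt_eq_mfderiv_chart {κ : G → F} {c : F} {g : G} (hg : g ∈ (chartAt F (1 : G)).source)
    (hc : κ =ᶠ[nhds g] fun g => chartAt F (1 : G) g - c) :
    derivAt F κ g = mfderiv 𝓘(ℝ, F) 𝓘(ℝ, F) (extChartAt 𝓘(ℝ, F) (1 : G)) g := by
  have h1 : HasMFDerivAt 𝓘(ℝ, F) 𝓘(ℝ, F) (extChartAt 𝓘(ℝ, F) (1 : G)) g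
    (mfderiv 𝓘(ℝ, F) 𝓘(ℝ, F) (extChartAt 𝓘(ℝ, F) (1 : G)) g) :=
    (mdifferentiableAt_extChartAt hg).hasMFDerivAt
  have h2 := ((h1.sub (hasMFDerivAt_const c g)).congr_of_eventuallyEq hc).mfderiv
  exact h2.trans (sub_zero _)

/-- The Lie bracket of `𝔤`, computed in a coordinate system. -/
theorem lie_eq_derivAt_leftDeriv {κ : G → F} (hκ : ContMDiff 𝓘(ℝ, F) 𝓘(ℝ, F) ∞ κ) {c : F}
    (hc : κ =ᶠ[nhds 1] fun g => chartAt F 1 g - c) (X Y : LieAlg F G) :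
    (⁅X, Y⁆ : LieAlg F G) =
      (derivAt F (leftDeriv F κ) 1 X Y - derivAt F (leftDeriv F κ) 1 Y X : F) := by
  have hone : derivAt F κ 1 = ContinuousLinearMap.id ℝ F :=
    (derivAt_eq_mfderiv_chart (mem_chart_source F 1) hc).trans mfderiv_extChartAt_self
  -- Read in the chart, a left-invariant field is the left derivative of the coordinate map: κ
  -- agrees with the chart up to a constant near each point involved, and the derivative of the
  -- chart inverts that of its inverse.
  have hfield (Z : LieAlg F G) :
      VectorField.mpullbackWithin 𝓘(ℝ, F) 𝓘(ℝ, F) (extChartAt 𝓘(ℝ, F) (1 : G)).symm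
        (mulInvariantVectorField Z) (Set.range 𝓘(ℝ, F)) =ᶠ[nhds (chartAt F (1 : G) 1)]
      fun x => leftDeriv F κ ((chartAt F (1 : G)).symm x) Z := by
    have h2 : Filter.Tendsto (chartAt F (1 : G)).symm (nhds (chartAt F (1 : G) 1)) (nhds 1) :=
      (chartAt F (1 : G)).tendsto_symm (mem_chart_source F 1)
    filter_upwards [h2.eventually hc.eventually_nhds, (chartAt F (1 : G)).open_target.mem_nhds
      (mem_chart_target F (1 : G))] with x hx hxt
    have hxt' : x ∈ (extChartAt 𝓘(ℝ, F) (1 : G)).target := by simpa using hxt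
    rw [leftDeriv_apply hκ, VectorField.mpullbackWithin_apply,
      ContinuousLinearMap.inverse_eq
        (mfderivWithin_extChartAt_symm_comp_mfderiv_extChartAt hxt')
        (mfderiv_extChartAt_comp_mfderivWithin_extChartAt_symm hxt'),
      derivAt_eq_mfderiv_chart ((chartAt F (1 : G)).map_target hxt) hx]
    rfl
  have hderiv (Z W : F) :
      fderiv ℝ (fun x => leftDeriv F κ ((chartAt F (1 : G)).symm x) Z) (chartAt F (1 : G) 1) W =
        derivAt F (leftDeriv F κ) 1 W Z := by
    rw [derivAt_eq_fderiv ((contMDiff_leftDeriv hκ).mdifferentiable infty_ne_zero _)]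
    have h := ((contDiffAt_comp_chart_symm (x := (1 : G))
      (contMDiff_leftDeriv hκ)).differentiableAt infty_ne_zero).hasFDerivAt
    have h2 := (h.clm_apply (hasFDerivAt_const Z _)).fderiv
    have h3 := congrArg (fun L : F →L[ℝ] F => L W) h2
    simpa using h3
  have hone' (Z : F) : leftDeriv F κ ((chartAt F (1 : G)).symm (chartAt F (1 : G) 1)) Z = Z := by
    rw [(chartAt F (1 : G)).left_inv (mem_chart_source F 1), leftDeriv_one, hone]
    rfl
  have hinv : @Eq (F →L[ℝ] F)
      (mfderiv 𝓘(ℝ, F) 𝓘(ℝ, F) (extChartAt 𝓘(ℝ, F) (1 : G)) 1).inverse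
      (ContinuousLinearMap.id ℝ F) :=
    Eq.trans (congrArg (fun L : F →L[ℝ] F => L.inverse) mfderiv_extChartAt_self)
      ContinuousLinearMap.inverse_id
  refine Eq.trans (congrFun (congrArg (fun L : F →L[ℝ] F => (L : F → F)) hinv) _) ?_
  have huniv : (extChartAt 𝓘(ℝ, F) (1 : G)).symm ⁻¹' Set.univ ∩ Set.range 𝓘(ℝ, F) = Set.univ := by
    rw [ModelWithCorners.range_eq_univ, Set.preimage_univ, Set.univ_inter]
  rw [huniv]
  refine (congrFun (VectorField.lieBracketWithin_univ (𝕜 := ℝ) (E := F)) _).trans ?_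
  refine ((hfield X).lieBracket_vectorField_eq (hfield Y)).trans ?_
  rw [VectorField.lieBracket]
  exact congrArg₂ (· - ·) ((congrArg _ (hone' X)).trans (hderiv Y X))
    ((congrArg _ (hone' Y)).trans (hderiv X Y))

/-- The derivative of the adjoint action: `d/dg Ad_{g⁻¹} Y = -⁅X, Y⁆` at `g = 1` along `X`. -/
theorem derivAt_adjoint_inv [T2Space G] (X Y : LieAlg F G) :
    derivAt F (fun g : G => (adjoint g⁻¹ : F →L[ℝ] F)) 1 X Y = (-⁅X, Y⁆ : LieAlg F G) := by
  -- A bump function extends the chart at 1 to a global smooth map; its existence uses the Hausdorff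
  -- property.
  obtain ⟨κ, c, hκ, hc⟩ : ∃ (κ : G → F) (c : F), ContMDiff 𝓘(ℝ, F) 𝓘(ℝ, F) ∞ κ ∧
      κ =ᶠ[nhds 1] fun g => chartAt F 1 g - c := by
    obtain ⟨χ⟩ : Nonempty (SmoothBumpFunction 𝓘(ℝ, F) (1 : G)) := inferInstance
    refine ⟨fun g => χ g • chartAt F 1 g, 0, χ.contMDiff_smul contMDiffOn_chart, ?_⟩
    filter_upwards [χ.eventuallyEq_one] with g hg
    simp [hg]
  -- For φ = κ the outer derivative at 1 is the identity, so the second derivative of the chart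
  -- gives both the derivative of Ad and, with opposite sign, the bracket.
  have h := derivAt_leftDeriv_sub hκ X Y
  rw [derivAt_eq_mfderiv_chart (mem_chart_source F 1) hc] at h
  have h2 := congrArg (fun L : F →L[ℝ] F =>
    L (derivAt F (fun g : G => (adjoint g⁻¹ : F →L[ℝ] F)) 1 X Y))
    (mfderiv_extChartAt_self (I := 𝓘(ℝ, F)) (x := (1 : G)))
  rw [lie_eq_derivAt_leftDeriv hκ hc X Y]
  refine (h.trans h2).symm.trans ?_
  exact (neg_sub _ _).symm

theorem derivAt_leftDeriv_sub_eq_lie [T2Space G] {φ : G → V}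
    (hφ : ContMDiff 𝓘(ℝ, F) 𝓘(ℝ, V) ∞ φ) (X Y : LieAlg F G) :
    derivAt F (leftDeriv F φ) 1 Y X - derivAt F (leftDeriv F φ) 1 X Y =
      -derivAt F φ 1 (⁅X, Y⁆ : LieAlg F G) := by
  refine (derivAt_leftDeriv_sub hφ X Y).trans ?_
  exact (congrArg (derivAt F φ 1) (derivAt_adjoint_inv X Y)).trans (map_neg (derivAt F φ 1) _)

end LieGroupCalculus

/-! ### Smooth integrals along segments -/

section Hadamard

set_option linter.unusedSectionVars false

/-- The integral is the value at 0 of the convolution of the indicator of (0, 1] with a cut-off of t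
↦ K p (-t), and convolution with a compactly supported smooth kernel is smooth in parameters. -/
theorem contDiffOn_integral {P W : Type*} [NormedAddCommGroup P] [NormedSpace ℝ P]
    [NormedAddCommGroup W] [NormedSpace ℝ W] {K : P → ℝ → W} {s : Set P} (hs : IsOpen s)
    (hK : ContDiffOn ℝ ∞ (Function.uncurry K) (s ×ˢ Set.univ)) :
    ContDiffOn ℝ ∞ (fun p => ∫ t in (0 : ℝ)..1, K p t) s := by
  -- Only β = 1 on [-1, 0] and compact support matter; the radii 2 and 3 leave room.
  let β : ContDiffBump (0 : ℝ) := ⟨2, 3, by norm_num, by norm_num⟩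
  let g : P → ℝ → W := fun p t => β t • K p (-t)
  have hg : ContDiffOn ℝ ∞ (Function.uncurry g) (s ×ˢ Set.univ) := by
    have h1 : ContDiffOn ℝ ∞ (fun p : P × ℝ => Function.uncurry K (p.1, -p.2))
        (s ×ˢ Set.univ) :=
      hK.comp (contDiff_fst.prodMk contDiff_snd.neg).contDiffOn fun p hp => ⟨hp.1, trivial⟩
    exact (β.contDiff.comp contDiff_snd).contDiffOn.smul h1
  have hf : MeasureTheory.LocallyIntegrable (Set.indicator (Set.Ioc (0 : ℝ) 1) fun _ => (1 : ℝ)) :=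
    ((MeasureTheory.integrable_indicator_iff measurableSet_Ioc).2
      (by simp)).locallyIntegrable
  have h := MeasureTheory.contDiffOn_convolution_right_with_param_comp (μ := MeasureTheory.volume)
    (n := ⊤) (g := g) (v := fun _ => (0 : ℝ)) (ContinuousLinearMap.lsmul ℝ ℝ) contDiffOn_const hs
    (isCompact_closedBall (0 : ℝ) 3) (fun p t _ ht => by
      have : β t = 0 := β.zero_of_le_dist (by
        rw [Metric.mem_closedBall, not_le] at ht
        exact ht.le)
      simp [g, this]) hf hg
  refine h.congr fun p _ => ?_
  rw [MeasureTheory.convolution, intervalIntegral.integral_of_le zero_le_one,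
    ← MeasureTheory.integral_indicator measurableSet_Ioc]
  refine MeasureTheory.integral_congr_ae (Filter.Eventually.of_forall fun t => ?_)
  by_cases ht : t ∈ Set.Ioc (0 : ℝ) 1
  · have : β (-t) = 1 := β.one_of_mem_closedBall (by
      rw [mem_closedBall_zero_iff, norm_neg, Real.norm_eq_abs, abs_of_pos ht.1]
      exact ht.2.trans one_le_two)
    simp [ht, g, this]
  · simp [ht]

variable {F E : Type*} [NormedAddCommGroup F] [NormedSpace ℝ F] [FiniteDimensional ℝ F]
  [NormedAddCommGroup E] [NormedSpace ℝ E]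
  {M : Type*} [TopologicalSpace M] [ChartedSpace E M] [IsManifold 𝓘(ℝ, E) ∞ M]

/-- The average of the derivative of `f` in the first variable over the segment from `x₀`. -/
def segmentDeriv (f : F × M → ℝ) (x₀ : F) (p : F × M) : F →L[ℝ] ℝ :=
  ∫ t in (0 : ℝ)..1, fderiv ℝ (fun x => f (x, p.2)) (x₀ + t • (p.1 - x₀))

/-- The fundamental theorem of calculus along the segment from x₀ to the first component of p. -/
theorem segmentDeriv_apply {f : F × M → ℝ} (hf : ContMDiff (𝓘(ℝ, F).prod 𝓘(ℝ, E)) 𝓘(ℝ, ℝ) ∞ f)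
    (x₀ : F) (p : F × M) : segmentDeriv f x₀ p (p.1 - x₀) = f p - f (x₀, p.2) := by
  have h1 : ContDiff ℝ ∞ (fun x => f (x, p.2)) := by
    rw [← contMDiff_iff_contDiff]
    exact hf.comp (contMDiff_id.prodMk contMDiff_const)
  have hline (t : ℝ) : HasDerivAt (fun t : ℝ => x₀ + t • (p.1 - x₀)) (p.1 - x₀) t := by
    simpa using ((hasDerivAt_id t).smul_const (p.1 - x₀)).const_add x₀
  have hcont : Continuous fun t : ℝ =>
      fderiv ℝ (fun x => f (x, p.2)) (x₀ + t • (p.1 - x₀)) :=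
    (h1.continuous_fderiv infty_ne_zero).comp (by fun_prop)
  rw [segmentDeriv, ContinuousLinearMap.intervalIntegral_apply (hcont.intervalIntegrable _ _)]
  have h2 := intervalIntegral.integral_eq_sub_of_hasDerivAt (a := 0) (b := 1)
    (f := fun t : ℝ => f (x₀ + t • (p.1 - x₀), p.2))
    (f' := fun t => fderiv ℝ (fun x => f (x, p.2)) (x₀ + t • (p.1 - x₀)) (p.1 - x₀))
    (fun t _ => ((h1.differentiable infty_ne_zero _).hasFDerivAt.comp_hasDerivAt t (hline t)))
    ((hcont.clm_apply continuous_const).intervalIntegrable _ _)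
  rw [h2]
  simp

theorem contMDiff_segmentDeriv {f : F × M → ℝ}
    (hf : ContMDiff (𝓘(ℝ, F).prod 𝓘(ℝ, E)) 𝓘(ℝ, ℝ) ∞ f) (x₀ : F) :
    ContMDiff (𝓘(ℝ, F).prod 𝓘(ℝ, E)) 𝓘(ℝ, F →L[ℝ] ℝ) ∞ (segmentDeriv f x₀) := by
  rintro ⟨x₁, m₁⟩
  let φ := chartAt E m₁
  let f' : F × E → ℝ := fun p => f (p.1, φ.symm p.2)
  have hopen : IsOpen ((Set.univ : Set F) ×ˢ φ.target) := isOpen_univ.prod φ.open_target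
  have hf' : ContDiffOn ℝ ∞ f' (Set.univ ×ˢ φ.target) := by
    have h : ContMDiffOn (𝓘(ℝ, F).prod 𝓘(ℝ, E)) 𝓘(ℝ, ℝ) ∞ f' (Set.univ ×ˢ φ.target) :=
      hf.comp_contMDiffOn (contMDiffOn_id.prodMap contMDiffOn_chart_symm)
    rw [← contMDiffOn_iff_contDiffOn, modelWithCornersSelf_prod, ← chartedSpaceSelf_prod]
    exact h
  have hfd : ContDiffOn ℝ ∞ (fderiv ℝ f') (Set.univ ×ˢ φ.target) :=
    hf'.fderiv_of_isOpen hopen (by simp)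
  -- In a chart of M, the derivative in the first variable is the restriction of a total derivative,
  -- hence jointly smooth.
  let K : F × E → ℝ → (F →L[ℝ] ℝ) := fun p t =>
    (fderiv ℝ f' (x₀ + t • (p.1 - x₀), p.2)).comp (ContinuousLinearMap.inl ℝ F E)
  have hK : ContDiffOn ℝ ∞ (Function.uncurry K) ((Set.univ ×ˢ φ.target) ×ˢ Set.univ) := by
    have hc : ContDiff ℝ ∞ fun p : (F × E) × ℝ => (x₀ + p.2 • (p.1.1 - x₀), p.1.2) := by fun_prop
    exact (hfd.comp hc.contDiffOn fun p hp => ⟨trivial, hp.1.2⟩).clm_comp contDiffOn_const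
  have hI := contDiffOn_integral hopen hK
  have hI' : ContMDiffAt (𝓘(ℝ, F).prod 𝓘(ℝ, E)) 𝓘(ℝ, F →L[ℝ] ℝ) ∞
      (fun p => ∫ t in (0 : ℝ)..1, K p t) (x₁, φ m₁) := by
    have h := (hI.contDiffAt (x := (x₁, φ m₁))
      (hopen.mem_nhds ⟨trivial, mem_chart_target E m₁⟩)).contMDiffAt
    rw [modelWithCornersSelf_prod, ← chartedSpaceSelf_prod] at h
    exact h
  have hchart : ContMDiffAt 𝓘(ℝ, E) 𝓘(ℝ, E) ∞ φ m₁ :=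
    contMDiffOn_chart.contMDiffAt (φ.open_source.mem_nhds (mem_chart_source E m₁))
  have hcomp : ContMDiffAt (𝓘(ℝ, F).prod 𝓘(ℝ, E)) 𝓘(ℝ, F →L[ℝ] ℝ) ∞
      ((fun p => ∫ t in (0 : ℝ)..1, K p t) ∘ Prod.map id φ) (x₁, m₁) :=
    hI'.comp (x₁, m₁) (contMDiffAt_id.prodMap hchart)
  refine hcomp.congr_of_eventuallyEq ?_
  have hsrc : ∀ᶠ p : F × M in nhds (x₁, m₁), p.2 ∈ φ.source :=
    continuous_snd.continuousAt.eventually (φ.open_source.mem_nhds (mem_chart_source E m₁))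
  filter_upwards [hsrc] with p hp
  refine intervalIntegral.integral_congr fun t _ => ?_
  have hd : DifferentiableAt ℝ f' (x₀ + t • (p.1 - x₀), φ p.2) :=
    (hf'.contDiffAt (hopen.mem_nhds ⟨trivial, φ.map_source hp⟩)).differentiableAt infty_ne_zero
  have e := (HasFDerivAt.comp (f := fun e => (e, φ p.2)) (x₀ + t • (p.1 - x₀)) hd.hasFDerivAt
      (hasFDerivAt_prodMk_left (x₀ + t • (p.1 - x₀)) (φ p.2))).fderiv
  refine Eq.trans ?_ e
  congr 1
  ext x
  simp [f', φ.left_inv hp]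

end Hadamard

/-! ### Hadamard's lemma with parameters -/

section Hadamard

variable {F E : Type*} [NormedAddCommGroup F] [NormedSpace ℝ F] [FiniteDimensional ℝ F]
  [NormedAddCommGroup E] [NormedSpace ℝ E]
  {M : Type*} [TopologicalSpace M] [ChartedSpace E M] [IsManifold 𝓘(ℝ, E) ∞ M]
  {N : Type*} [TopologicalSpace N] [T2Space N] [ChartedSpace F N] [IsManifold 𝓘(ℝ, F) ∞ N]

variable (F E M) in
/-- Hadamard's lemma with parameters: near `n₀`, a smooth function on `N × M` differs from its
restriction to `{n₀} × M` by a combination of the coordinates of `N` with smooth coefficients. -/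
theorem exists_hadamard (n₀ : N) :
    ∃ κ : N → F, ContMDiff 𝓘(ℝ, F) 𝓘(ℝ, F) ∞ κ ∧ κ n₀ = 0 ∧
      (κ =ᶠ[nhds n₀] fun n => chartAt F n₀ n - chartAt F n₀ n₀) ∧
      ∃ q : C^∞⟮𝓘(ℝ, F), N; ℝ⟯, q n₀ = 0 ∧
      ∀ f : C^∞⟮𝓘(ℝ, F).prod 𝓘(ℝ, E), N × M; ℝ⟯, ∃ h : N × M → F →L[ℝ] ℝ,
        ContMDiff (𝓘(ℝ, F).prod 𝓘(ℝ, E)) 𝓘(ℝ, F →L[ℝ] ℝ) ∞ h ∧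
        ∀ n m, f (n, m) = f (n₀, m) + h (n, m) (κ n) + q n * (f (n, m) - f (n₀, m)) := by
  obtain ⟨χ⟩ : Nonempty (SmoothBumpFunction 𝓘(ℝ, F) n₀) := inferInstance
  let φ := chartAt F n₀
  let β := χ.toContDiffBump
  have hβ : ∀ x, x ∉ φ.target → x ∉ tsupport β := fun x hx hx' => hx (by
    rw [ContDiffBump.tsupport_eq] at hx'
    simpa using χ.closedBall_subset ⟨hx', by simp⟩)
  have hχ : ∀ n ∈ φ.source, χ n = β (φ n) := fun n hn => χ.eqOn_source hn
  have hχ0 : ∀ n, n ∉ φ.source → χ n = 0 := fun n hn =>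
    Function.notMem_support.1 fun h => hn (χ.support_subset_source h)
  -- The exponent 3 counts cut-offs: one χ in κ, one in h, and one in the function integrated along
  -- segments. Thus h(κ) is χ³ times the increment of f, and q carries the remainder.
  refine ⟨fun n => χ n • (φ n - φ n₀), χ.contMDiff_smul (contMDiffOn_chart.sub contMDiffOn_const),
    by simp, ?_,
    ⟨fun n => 1 - χ n ^ 3, contMDiff_const.sub (χ.contMDiff.pow 3)⟩, ?_, fun f => ?_⟩
  · filter_upwards [χ.eventuallyEq_one] with n hn
    simp [hn, φ]
  · change 1 - χ n₀ ^ 3 = 0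
    simp
  let w : N × M → ℝ := fun p => f p - f (n₀, p.2)
  have hw : ContMDiff (𝓘(ℝ, F).prod 𝓘(ℝ, E)) 𝓘(ℝ, ℝ) ∞ w :=
    f.contMDiff.sub (f.contMDiff.comp (contMDiff_const.prodMk contMDiff_snd))
  -- The cut-off makes the increment of f smooth on all of F × M, so a segment may leave the chart
  -- target, which need not be convex.
  let f' : F × M → ℝ := fun p => β p.1 • w (φ.symm p.1, p.2)
  have hf' : ContMDiff (𝓘(ℝ, F).prod 𝓘(ℝ, E)) 𝓘(ℝ, ℝ) ∞ f' := by
    rintro ⟨x, m⟩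
    by_cases hx : x ∈ φ.target
    · have h1 : ContMDiffAt 𝓘(ℝ, F) 𝓘(ℝ, F) ∞ φ.symm x :=
        contMDiffOn_chart_symm.contMDiffAt (φ.open_target.mem_nhds hx)
      have h2 : ContMDiffAt (𝓘(ℝ, F).prod 𝓘(ℝ, E)) (𝓘(ℝ, F).prod 𝓘(ℝ, E)) ∞
        (Prod.map φ.symm (id : M → M)) (x, m) := h1.prodMap contMDiffAt_id
      exact (β.contDiff.contMDiff.comp contMDiff_fst).contMDiffAt.smul
        (hw.contMDiffAt.comp (x, m) h2)
    · have h : ∀ᶠ p : F × M in nhds (x, m), p.1 ∈ (tsupport β)ᶜ :=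
        continuous_fst.continuousAt.eventually
          ((isClosed_tsupport β).isOpen_compl.mem_nhds (hβ x hx))
      refine (contMDiffAt_const (c := (0 : ℝ))).congr_of_eventuallyEq ?_
      filter_upwards [h] with p hp
      have h0 : β p.1 = 0 := image_eq_zero_of_notMem_tsupport hp
      exact (congrArg (· • w (φ.symm p.1, p.2)) h0).trans (zero_smul ℝ _)
  let H := segmentDeriv f' (φ n₀)
  refine ⟨fun p => χ p.1 • H (φ p.1, p.2), ?_, fun n m => ?_⟩
  · rintro ⟨n, m⟩
    by_cases hn : n ∈ φ.source
    · have h1 : ContMDiffAt 𝓘(ℝ, F) 𝓘(ℝ, F) ∞ φ n :=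
        contMDiffOn_chart.contMDiffAt (φ.open_source.mem_nhds hn)
      have h2 : ContMDiffAt (𝓘(ℝ, F).prod 𝓘(ℝ, E)) (𝓘(ℝ, F).prod 𝓘(ℝ, E)) ∞
        (Prod.map φ (id : M → M)) (n, m) := h1.prodMap contMDiffAt_id
      exact (χ.contMDiff.comp contMDiff_fst).contMDiffAt.smul
        ((contMDiff_segmentDeriv hf' _).contMDiffAt.comp (n, m) h2)
    · have h : ∀ᶠ p : N × M in nhds (n, m), p.1 ∈ (tsupport χ)ᶜ :=
        continuous_fst.continuousAt.eventually ((isClosed_tsupport χ).isOpen_compl.mem_nhds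
          fun h => hn (χ.tsupport_subset_chartAt_source h))
      refine (contMDiffAt_const (c := (0 : F →L[ℝ] ℝ))).congr_of_eventuallyEq ?_
      filter_upwards [h] with p hp
      simp [image_eq_zero_of_notMem_tsupport hp]
  · by_cases hn : n ∈ φ.source
    · have h1 := segmentDeriv_apply hf' (φ n₀) (φ n, m)
      have h2 : f' (φ n₀, m) = 0 := by
        simp [f', w, φ]
      have h3 : f' (φ n, m) = χ n * (f (n, m) - f (n₀, m)) := by
        simp [f', w, φ.left_inv hn, hχ n hn]
      rw [h2, h3] at h1
      simp only [smul_apply, map_smul, smul_eq_mul, H]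
      rw [h1]
      change _ = _ + _ + (1 - χ n ^ 3) * _
      ring
    · change _ = _ + _ + (1 - χ n ^ 3) * _
      simp [hχ0 n hn]

end Hadamard

/-! ### Rules of differentiation -/

section DerivRules

variable {E₁ : Type*} [NormedAddCommGroup E₁] [NormedSpace ℝ E₁]
  {N : Type*} [TopologicalSpace N] [ChartedSpace E₁ N]
  {V W : Type*} [NormedAddCommGroup V] [NormedSpace ℝ V] [NormedAddCommGroup W] [NormedSpace ℝ W]

theorem derivAt_comp {f : N → V} {Φ : V → W} {x : N}
    (hΦ : DifferentiableAt ℝ Φ (f x)) (hf : MDifferentiableAt 𝓘(ℝ, E₁) 𝓘(ℝ, V) f x) :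
    derivAt E₁ (fun y => Φ (f y)) x = (fderiv ℝ Φ (f x)).comp (derivAt E₁ f x) :=
  (hΦ.hasFDerivAt.hasMFDerivAt.comp x hf.hasMFDerivAt).mfderiv

theorem derivAt_clm_comp (L : V →L[ℝ] W) {f : N → V} {x : N}
    (hf : MDifferentiableAt 𝓘(ℝ, E₁) 𝓘(ℝ, V) f x) (X : E₁) :
    derivAt E₁ (fun y => L (f y)) x X = L (derivAt E₁ f x X) := by
  rw [derivAt_comp L.differentiableAt hf, L.fderiv]
  rfl

theorem derivAt_clm_apply {f : N → V →L[ℝ] W} {x : N}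
    (hf : MDifferentiableAt 𝓘(ℝ, E₁) 𝓘(ℝ, V →L[ℝ] W) f x) (v : V) (X : E₁) :
    derivAt E₁ (fun y => f y v) x X = derivAt E₁ f x X v :=
  derivAt_clm_comp (ContinuousLinearMap.apply ℝ W v) hf X

theorem derivAt_const (c : V) (x : N) : derivAt E₁ (fun _ => c) x = 0 := mfderiv_const

theorem derivAt_add {f g : N → V} {x : N} (hf : MDifferentiableAt 𝓘(ℝ, E₁) 𝓘(ℝ, V) f x)
    (hg : MDifferentiableAt 𝓘(ℝ, E₁) 𝓘(ℝ, V) g x) :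
    derivAt E₁ (fun y => f y + g y) x = derivAt E₁ f x + derivAt E₁ g x :=
  (hf.hasMFDerivAt.add hg.hasMFDerivAt).mfderiv

theorem derivAt_mul {f g : N → ℝ} {x : N} (hf : MDifferentiableAt 𝓘(ℝ, E₁) 𝓘(ℝ, ℝ) f x)
    (hg : MDifferentiableAt 𝓘(ℝ, E₁) 𝓘(ℝ, ℝ) g x) :
    derivAt E₁ (fun y => f y * g y) x = f x • derivAt E₁ g x + g x • derivAt E₁ f x :=
  (hf.hasMFDerivAt.mul hg.hasMFDerivAt).mfderiv

end DerivRules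

/-! ### Extending derivations of functions to the Koszul algebra -/

section TensorDerivation

variable {R R' : Type*} [CommRing R] [Algebra ℝ R] [CommRing R'] [Algebra ℝ R']
  {V : Type*} [AddCommGroup V] [Module ℝ V]

namespace Koszul

theorem rTensor_ofBase (d : R →ₗ[ℝ] R') (f : R) :
    LinearMap.rTensor (ExteriorAlgebra ℝ V) d (ofBase f) = ofBase (d f) := rfl

theorem rTensor_generator_mul (d : R →ₗ[ℝ] R') (v : V) (z : Koszul R V) :
    LinearMap.rTensor (ExteriorAlgebra ℝ V) d (generator v * z) =
      generator v * LinearMap.rTensor (ExteriorAlgebra ℝ V) d z := by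
  induction z using TensorProduct.induction_on with
  | zero => simp
  | add y z hy hz => simp only [mul_add, map_add, hy, hz]
  | tmul r w => simp only [generator_mul_tmul, LinearMap.rTensor_tmul]

theorem rTensor_mem_degree (d : R →ₗ[ℝ] R') {n : ℤ} {z : Koszul R V} (hz : z ∈ degree R V n) :
    LinearMap.rTensor (ExteriorAlgebra ℝ V) d z ∈ degree R' V n :=
  tmul_induction (p := fun n z => LinearMap.rTensor (ExteriorAlgebra ℝ V) d z ∈ degree R' V n) hz
    (by simp) (fun n y z hy hz => by rw [map_add]; exact add_mem hy hz)
    fun _ _ _ hw => tmul_mem_degree _ hw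

theorem map_eq_rTensor (φ : R →ₐ[ℝ] R') (z : Koszul R V) :
    Algebra.TensorProduct.map φ (AlgHom.id ℝ (ExteriorAlgebra ℝ V)) z =
      LinearMap.rTensor (ExteriorAlgebra ℝ V) φ.toLinearMap z := by
  induction z using TensorProduct.induction_on with
  | zero => simp
  | add y z hy hz => rw [map_add, hy, hz, map_add]
  | tmul r w => rfl

/-- No sign appears because d ⊗ id has degree 0 and acts only on the commutative factor. -/
theorem rTensor_mul {φ : R →ₐ[ℝ] R'} {d : R →ₗ[ℝ] R'}
    (hd : ∀ f g, d (f * g) = d f * φ g + φ f * d g) (y z : Koszul R V) :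
    LinearMap.rTensor (ExteriorAlgebra ℝ V) d (y * z) =
      LinearMap.rTensor (ExteriorAlgebra ℝ V) d y *
          Algebra.TensorProduct.map φ (AlgHom.id ℝ _) z +
        Algebra.TensorProduct.map φ (AlgHom.id ℝ _) y *
          LinearMap.rTensor (ExteriorAlgebra ℝ V) d z := by
  induction y using TensorProduct.induction_on with
  | zero => simp
  | add x y hx hy => simp only [add_mul, map_add, hx, hy]; abel
  | tmul r v =>
    induction z using TensorProduct.induction_on with
    | zero => simp
    | add y z hy hz => simp only [mul_add, map_add, hy, hz]; abel
    | tmul s w =>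
      simp [Algebra.TensorProduct.tmul_mul_tmul, hd, TensorProduct.add_tmul]

/-- The contraction has coefficients in the image of φ, over which d is linear, so d ⊗ id passes
through it. -/
theorem rTensor_differential [FiniteDimensional ℝ V] {φ : R' →ₐ[ℝ] R} {d : R →ₗ[ℝ] R'}
    (hd : ∀ f g, d (φ f * g) = f * d g) (s : V →ₗ[ℝ] R') (z : Koszul R V) :
    LinearMap.rTensor (ExteriorAlgebra ℝ V) d (differential (φ.toLinearMap ∘ₗ s) z) =
      differential s (LinearMap.rTensor (ExteriorAlgebra ℝ V) d z) := by
  have hb (f : R') (z : Koszul R V) :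
      LinearMap.rTensor (ExteriorAlgebra ℝ V) d (ofBase (φ f) * z) =
        ofBase f * LinearMap.rTensor (ExteriorAlgebra ℝ V) d z := by
    induction z using TensorProduct.induction_on with
    | zero => simp
    | add y z hy hz => simp only [mul_add, map_add, hy, hz]
    | tmul r w => simp only [ofBase_mul_tmul, LinearMap.rTensor_tmul, hd]
  induction z using induction with
  | ofBase f => rw [differential_ofBase, rTensor_ofBase, differential_ofBase, map_zero]
  | generator_mul v z hz =>
    rw [differential_generator_mul, rTensor_generator_mul, differential_generator_mul, map_sub,
      rTensor_generator_mul, hz]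
    congr 1
    exact hb _ _
  | add y z hy hz => simp only [map_add, hy, hz]

end Koszul

end TensorDerivation

/-! ### The map Ψ and its compatibility with the differentials -/

section UnitDerivative

set_option linter.unusedSectionVars false

variable {F E : Type*} [NormedAddCommGroup F] [NormedSpace ℝ F] [FiniteDimensional ℝ F]
  [NormedAddCommGroup E] [NormedSpace ℝ E]
  {G : Type*} [TopologicalSpace G] [ChartedSpace F G] [Group G] [LieGroup 𝓘(ℝ, F) ∞ G]
  {M : Type*} [TopologicalSpace M] [ChartedSpace E M] [IsManifold 𝓘(ℝ, E) ∞ M]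
  [MulAction G M] [ContMDiffSMul 𝓘(ℝ, F) 𝓘(ℝ, E) ∞ G M]

theorem contMDiff_slice (f : C^∞⟮𝓘(ℝ, F).prod 𝓘(ℝ, E), G × M; ℝ⟯) (m : M) :
    ContMDiff 𝓘(ℝ, F) 𝓘(ℝ, ℝ) ∞ (fun g => f (g, m)) :=
  f.contMDiff.comp (contMDiff_id.prodMk contMDiff_const)

theorem mdifferentiableAt_slice (f : C^∞⟮𝓘(ℝ, F).prod 𝓘(ℝ, E), G × M; ℝ⟯) (m : M) (g : G) :
    MDifferentiableAt 𝓘(ℝ, F) 𝓘(ℝ, ℝ) (fun g => f (g, m)) g :=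
  (contMDiff_slice f m).mdifferentiable infty_ne_zero g

variable (F E G M) in
/-- The derivative of functions on `G × M` at the unit, in the direction of `𝔤`. -/
def unitDeriv : LieAlg F G →ₗ[ℝ] C^∞⟮𝓘(ℝ, F).prod 𝓘(ℝ, E), G × M; ℝ⟯ →ₗ[ℝ] C^∞⟮𝓘(ℝ, E), M; ℝ⟯ :=
  LinearMap.mk₂ ℝ
    (fun X f => ⟨fun m => derivAt F (fun g => f (g, m)) 1 X,
      (contMDiff_derivAt_right (ψ := fun p : M × G => f (p.2, p.1))
        (f.contMDiff.comp (contMDiff_snd.prodMk contMDiff_fst)) 1).clm_apply contMDiff_const⟩)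
    (fun X Y f => by
      ext m
      exact map_add (derivAt F (fun g => f (g, m)) 1) X Y)
    (fun c X f => by
      ext m
      exact map_smul (derivAt F (fun g => f (g, m)) 1) c X)
    (fun X f g => by
      ext m
      exact congrArg (fun L : F →L[ℝ] ℝ => L X)
        (derivAt_add (mdifferentiableAt_slice f m 1) (mdifferentiableAt_slice g m 1)))
    (fun c X f => by
      ext m
      exact derivAt_clm_comp (c • ContinuousLinearMap.id ℝ ℝ) (mdifferentiableAt_slice f m 1) X)

theorem unitDeriv_mul (X : LieAlg F G) (f h : C^∞⟮𝓘(ℝ, F).prod 𝓘(ℝ, E), G × M; ℝ⟯) :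
    unitDeriv F E G M X (f * h) = unitDeriv F E G M X f * pullback (unit F E G M) h +
      pullback (unit F E G M) f * unitDeriv F E G M X h := by
  ext m
  refine (congrArg (fun L : F →L[ℝ] ℝ => L X)
    (derivAt_mul (mdifferentiableAt_slice f m 1) (mdifferentiableAt_slice h m 1))).trans ?_
  change f (1, m) * derivAt F (fun g => h (g, m)) 1 X +
      h (1, m) * derivAt F (fun g => f (g, m)) 1 X =
    derivAt F (fun g => f (g, m)) 1 X * h (1, m) + f (1, m) * derivAt F (fun g => h (g, m)) 1 X
  ring

theorem unitDeriv_proj (X : LieAlg F G) (f : C^∞⟮𝓘(ℝ, E), M; ℝ⟯) :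
    unitDeriv F E G M X (pullback (proj F E G M) f) = 0 := by
  ext m
  exact congrArg (fun L : F →L[ℝ] ℝ => L X) (derivAt_const (f m) (1 : G))

theorem unit_proj (f : C^∞⟮𝓘(ℝ, E), M; ℝ⟯) :
    pullback (unit F E G M) (pullback (proj F E G M) f) = f := rfl

theorem unitDeriv_proj_mul (X : LieAlg F G) (f : C^∞⟮𝓘(ℝ, E), M; ℝ⟯)
    (h : C^∞⟮𝓘(ℝ, F).prod 𝓘(ℝ, E), G × M; ℝ⟯) :
    unitDeriv F E G M X (pullback (proj F E G M) f * h) = f * unitDeriv F E G M X h := by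
  rw [unitDeriv_mul, unitDeriv_proj, zero_mul, zero_add, unit_proj]

variable (F E G M) in
/-- The isomorphism `C^∞(𝒵) ⊗ 𝔤 → A`, `a ⊗ X ↦ a • (∂_X ⊗ id)`. -/
def psi : TrivZ F E G M →ₗ[FnZ F E G M] (FnGZ F E G M →ₗ[ℝ] FnZ F E G M) :=
  extendScalars (A := FnZ F E G M) (P := FnGZ F E G M →ₗ[ℝ] FnZ F E G M)
    (LinearMap.rTensorHom (ExteriorAlgebra ℝ (LieAlg F G)) ∘ₗ unitDeriv F E G M)

theorem psi_tmul (a : FnZ F E G M) (X : LieAlg F G) (z : FnGZ F E G M) :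
    psi F E G M (a ⊗ₜ X) z = a * LinearMap.rTensor _ (unitDeriv F E G M X) z := by
  rw [psi, extendScalars_tmul]
  rfl

theorem psi_mem_algebroid {n : ℤ} {x : TrivZ F E G M} (hx : x ∈ trivDegree F E G M n) :
    psi F E G M x ∈ algebroid F E G M n := by
  refine tensorDegree_induction (p := fun x => psi F E G M x ∈ algebroid F E G M n) (by simp)
    (fun x y hx hy => by rw [map_add]; exact add_mem hx hy) (fun a ha X => ⟨⟨?_, ?_⟩, ?_⟩) hx
  · intro k g hg
    rw [psi_tmul, add_comm]
    exact Koszul.mul_mem_degree ha (Koszul.rTensor_mem_degree _ hg)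
  · intro k g hg l h _
    have hu : unitPullback F E G M g ∈ Koszul.degree C^∞⟮𝓘(ℝ, E), M; ℝ⟯ (LieAlg F G) k := by
      rw [unitPullback, Koszul.map_eq_rTensor]
      exact Koszul.rTensor_mem_degree _ hg
    rw [psi_tmul, psi_tmul, psi_tmul, Koszul.rTensor_mul (unitDeriv_mul X), mul_add, ← mul_assoc,
      ← mul_assoc]
    congr 1
    change a * unitPullback F E G M g * _ = _ • (unitPullback F E G M g * _)
    -- The Leibniz sign of a derivation of degree |a| is the cost of moving a past `u^* g`.
    rw [Koszul.mul_comm_degree ha hu, smul_mul_assoc, mul_assoc]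
  · intro h
    rw [psi_tmul, sourcePullback, Koszul.map_eq_rTensor, ← LinearMap.comp_apply,
      ← LinearMap.rTensor_comp]
    have e : unitDeriv F E G M X ∘ₗ (pullback (proj F E G M)).toLinearMap = 0 :=
      LinearMap.ext (unitDeriv_proj X)
    rw [e, LinearMap.rTensor_zero, LinearMap.zero_apply, mul_zero]

/-- The operator ∂_X ⊗ id commutes with the differentials, so only the derivative of the coefficient
survives in the commutator. -/
theorem psi_diffTriv (μ : MomentMap F E G M) {n : ℤ} {x : TrivZ F E G M}
    (hx : x ∈ trivDegree F E G M n) :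
    psi F E G M (μ.diffTriv (LieAlg F G) x) =
      homDifferential μ.diffGZ μ.diffZ n (psi F E G M x) := by
  refine tensorDegree_induction (p := fun x => psi F E G M (μ.diffTriv (LieAlg F G) x) =
      homDifferential μ.diffGZ μ.diffZ n (psi F E G M x)) (by simp [homDifferential])
    (fun x y hx hy => by
      simp only [map_add, hx, hy, homDifferential, LinearMap.comp_add, LinearMap.add_comp,
        smul_add]
      abel)
    (fun a ha X => ?_) hx
  refine LinearMap.ext fun z => ?_
  simp only [homDifferential, LinearMap.sub_apply, LinearMap.comp_apply, LinearMap.smul_apply,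
    MomentMap.diffTriv, LinearMap.rTensor_tmul, psi_tmul, MomentMap.diffZ, MomentMap.diffGZ]
  rw [Koszul.differential_mul _ ha, Koszul.rTensor_differential (unitDeriv_proj_mul X)]
  abel

end UnitDerivative

/-! ### Bijectivity of Ψ -/

section Isomorphism

set_option linter.unusedSectionVars false

variable {F E : Type*} [NormedAddCommGroup F] [NormedSpace ℝ F] [FiniteDimensional ℝ F]
  [NormedAddCommGroup E] [NormedSpace ℝ E]
  {G : Type*} [TopologicalSpace G] [ChartedSpace F G] [Group G] [LieGroup 𝓘(ℝ, F) ∞ G]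
  {M : Type*} [TopologicalSpace M] [ChartedSpace E M] [IsManifold 𝓘(ℝ, E) ∞ M]
  [MulAction G M] [ContMDiffSMul 𝓘(ℝ, F) 𝓘(ℝ, E) ∞ G M]

theorem sourcePullback_mem_degree {n : ℤ} {z : FnZ F E G M}
    (hz : z ∈ Koszul.degree C^∞⟮𝓘(ℝ, E), M; ℝ⟯ (LieAlg F G) n) :
    sourcePullback F E G M z ∈
      Koszul.degree C^∞⟮𝓘(ℝ, F).prod 𝓘(ℝ, E), G × M; ℝ⟯ (LieAlg F G) n := by
  rw [sourcePullback, Koszul.map_eq_rTensor]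
  exact Koszul.rTensor_mem_degree _ hz

theorem unitPullback_ofBase (f : C^∞⟮𝓘(ℝ, F).prod 𝓘(ℝ, E), G × M; ℝ⟯) :
    unitPullback F E G M (Koszul.ofBase f) = Koszul.ofBase (pullback (unit F E G M) f) := rfl

theorem sourcePullback_ofBase (f : C^∞⟮𝓘(ℝ, E), M; ℝ⟯) :
    sourcePullback F E G M (Koszul.ofBase f) = Koszul.ofBase (pullback (proj F E G M) f) := rfl

theorem algebroid_ofBase_mul {n : ℤ} {α : FnGZ F E G M →ₗ[ℝ] FnZ F E G M}
    (hα : α ∈ algebroid F E G M n) (f h : C^∞⟮𝓘(ℝ, F).prod 𝓘(ℝ, E), G × M; ℝ⟯) :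
    α (Koszul.ofBase (f * h)) = α (Koszul.ofBase f) * Koszul.ofBase (pullback (unit F E G M) h) +
      Koszul.ofBase (pullback (unit F E G M) f) * α (Koszul.ofBase h) := by
  have h1 := hα.1.2 0 _ (Koszul.ofBase_mem_degree f) 0 _ (Koszul.ofBase_mem_degree h)
  rwa [mul_zero, zpow_zero, one_smul, ← map_mul, unitPullback_ofBase, unitPullback_ofBase] at h1

/-- Derivations along the unit that vanish along the source are determined by their values on
functions on `G × M`. -/
theorem algebroid_eq_zero_of_ofBase {n : ℤ} {α : FnGZ F E G M →ₗ[ℝ] FnZ F E G M}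
    (hα : α ∈ algebroid F E G M n) (h : ∀ f, α (Koszul.ofBase f) = 0) : α = 0 := by
  -- Elements f · `s^*` z span C^∞(G × 𝒵), because the exterior generators are themselves pulled
  -- back along the source.
  have key (f : C^∞⟮𝓘(ℝ, F).prod 𝓘(ℝ, E), G × M; ℝ⟯) (z : FnZ F E G M) :
      α (Koszul.ofBase f * sourcePullback F E G M z) = 0 := by
    induction z using Koszul.induction_degree with
    | mem k z hz =>
      rw [hα.1.2 0 _ (Koszul.ofBase_mem_degree f) k _ (sourcePullback_mem_degree hz), h, hα.2 z]
      simp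
    | add y z hy hz => rw [map_add, mul_add, map_add, hy, hz, add_zero]
  refine TensorProduct.ext' fun f w => ?_
  have h1 := key f (1 ⊗ₜ w)
  have h2 : sourcePullback F E G M (1 ⊗ₜ w) = 1 ⊗ₜ w := by
    rw [sourcePullback, Algebra.TensorProduct.map_tmul, map_one]
    rfl
  rwa [h2, Koszul.ofBase_mul_tmul, mul_one] at h1

variable (F E G M) in
/-- Coordinates of `G` at `1` as functions on `G × M`: they are dual to a basis of `𝔤`, and elements
of the algebroid are determined by their values on them. -/
theorem exists_coordinates [T2Space G] :
    ∃ c : Fin (Module.finrank ℝ (LieAlg F G)) → C^∞⟮𝓘(ℝ, F).prod 𝓘(ℝ, E), G × M; ℝ⟯,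
      (∀ X i, unitDeriv F E G M X (c i) =
        algebraMap ℝ _ ((Module.finBasis ℝ (LieAlg F G)).coord i X)) ∧
      ∀ n, ∀ α ∈ algebroid F E G M n, (∀ i, α (Koszul.ofBase (c i)) = 0) → α = 0 := by
  obtain ⟨κ, hκ, hκ1, hc, q, hq, hf⟩ := exists_hadamard F E M (1 : G)
  have hone : derivAt F κ 1 = ContinuousLinearMap.id ℝ F :=
    (derivAt_eq_mfderiv_chart (mem_chart_source F 1) hc).trans mfderiv_extChartAt_self
  let b := Module.finBasis ℝ (LieAlg F G)
  let L (i) : F →L[ℝ] ℝ := LinearMap.toContinuousLinearMap (E := F) (F' := ℝ) (b.coord i)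
  let c (i) : C^∞⟮𝓘(ℝ, F).prod 𝓘(ℝ, E), G × M; ℝ⟯ :=
    ⟨fun p => L i (κ p.1), (L i).contMDiff.comp (hκ.comp contMDiff_fst)⟩
  refine ⟨c, fun X i => ?_, fun n α hα h0 => algebroid_eq_zero_of_ofBase hα fun f => ?_⟩
  · ext m
    have h := derivAt_clm_comp (L i) (hκ.mdifferentiable infty_ne_zero (1 : G)) (X : F)
    rw [hone] at h
    exact h
  · obtain ⟨h, hh, hfh⟩ := hf f
    let h' (i) : C^∞⟮𝓘(ℝ, F).prod 𝓘(ℝ, E), G × M; ℝ⟯ :=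
      ⟨fun p => h p (b i), hh.clm_apply contMDiff_const⟩
    let q' : C^∞⟮𝓘(ℝ, F).prod 𝓘(ℝ, E), G × M; ℝ⟯ := q.comp ⟨Prod.fst, contMDiff_fst⟩
    let f₀ := pullback (proj F E G M) (pullback (unit F E G M) f)
    -- α kills f₀, a pullback from M. It kills c_i h'_i because c_i vanishes on the unit section and
    -- α(c_i) = 0, and it kills the last term because both factors vanish there. The last term
    -- replaces a localisation argument.
    have hdecomp : f = f₀ + ∑ i, c i * h' i + q' * (f - f₀) := by
      ext ⟨g, m⟩
      have hsum : h (g, m) (κ g) = (∑ i, c i * h' i) (g, m) := by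
        have e (l : LieAlg F G →ₗ[ℝ] ℝ) (v : LieAlg F G) : l v = ∑ i, b.coord i v * l (b i) := by
          conv_lhs => rw [← b.sum_repr v, map_sum]
          simp
        exact (e (h (g, m)).toLinearMap (κ g)).trans
          (map_sum (ContMDiffMap.evalRingHom (I := 𝓘(ℝ, F).prod 𝓘(ℝ, E)) (I' := 𝓘(ℝ, ℝ)) (n := ∞)
            ((g, m) : G × M)) (fun i => c i * h' i) Finset.univ).symm
      refine (hfh g m).trans ?_
      rw [hsum]
      rfl
    have hc1 (i) : pullback (unit F E G M) (c i) = 0 := by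
      ext m
      exact (congrArg (L i) hκ1).trans (map_zero _)
    have hq1 : pullback (unit F E G M) q' = 0 := by
      ext m
      exact hq
    have hf₀ : pullback (unit F E G M) f₀ = pullback (unit F E G M) f := rfl
    have hα₀ : α (Koszul.ofBase f₀) = 0 := by
      rw [← sourcePullback_ofBase]
      exact hα.2 _
    rw [hdecomp, map_add, map_add, map_add, map_add, map_sum, map_sum, hα₀,
      algebroid_ofBase_mul hα, hq1, map_sub, hf₀, sub_self]
    simp only [algebroid_ofBase_mul hα, hc1, h0]
    simp

/-- The coordinates are dual to the basis of 𝔤, so evaluation on them is an explicit left inverse of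
Ψ. This gives injectivity and dictates the preimage in the surjectivity proof. -/
theorem sum_psi_tmul {c : Fin (Module.finrank ℝ (LieAlg F G)) →
      C^∞⟮𝓘(ℝ, F).prod 𝓘(ℝ, E), G × M; ℝ⟯}
    (hc : ∀ X i, unitDeriv F E G M X (c i) =
      algebraMap ℝ _ ((Module.finBasis ℝ (LieAlg F G)).coord i X)) (x : TrivZ F E G M) :
    ∑ i, psi F E G M x (Koszul.ofBase (c i)) ⊗ₜ[ℝ] Module.finBasis ℝ (LieAlg F G) i = x := by
  induction x using TensorProduct.induction_on with
  | zero => simp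
  | add x y hx hy =>
    simp only [map_add, LinearMap.add_apply, TensorProduct.add_tmul, Finset.sum_add_distrib, hx, hy]
  | tmul a X =>
    conv_rhs => rw [← (Module.finBasis ℝ (LieAlg F G)).sum_repr X, TensorProduct.tmul_sum]
    refine Finset.sum_congr rfl fun i _ => ?_
    rw [psi_tmul, Koszul.rTensor_ofBase, hc, AlgHom.commutes, ← Algebra.commutes,
      ← Algebra.smul_def, TensorProduct.tmul_smul, TensorProduct.smul_tmul']
    rfl

theorem bijOn_psi [T2Space G] (n : ℤ) :
    Set.BijOn (psi F E G M) (trivDegree F E G M n) (algebroid F E G M n) := by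
  obtain ⟨c, hc, hext⟩ := exists_coordinates F E G M
  refine ⟨fun x hx => psi_mem_algebroid hx, fun x _ y _ hxy => ?_, fun α hα => ?_⟩
  · rw [← sum_psi_tmul hc x, hxy, sum_psi_tmul hc y]
  · let b := Module.finBasis ℝ (LieAlg F G)
    have hx : ∑ i, α (Koszul.ofBase (c i)) ⊗ₜ[ℝ] b i ∈ trivDegree F E G M n :=
      sum_mem fun i _ => tmul_mem_tensorDegree
        (by simpa using hα.1.1 0 _ (Koszul.ofBase_mem_degree (c i))) _
    -- The candidate and α have equal values on the coordinates, and an element of A is determined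
    -- by these.
    refine ⟨_, hx, sub_eq_zero.1 (hext n _ (sub_mem (psi_mem_algebroid hx) hα) fun i => ?_)⟩
    rw [LinearMap.sub_apply, map_sum, LinearMap.sum_apply, sub_eq_zero,
      Finset.sum_eq_single i]
    · rw [psi_tmul, Koszul.rTensor_ofBase, hc]
      simp [b]
    · intro j _ hj
      rw [psi_tmul, Koszul.rTensor_ofBase, hc]
      simp [b, hj]
    · simp

end Isomorphism

/-! ### The infinitesimal action on C^∞(𝒵) -/

section Anchor

set_option linter.unusedSectionVars false

variable {F E : Type*} [NormedAddCommGroup F] [NormedSpace ℝ F] [FiniteDimensional ℝ F]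
  [NormedAddCommGroup E] [NormedSpace ℝ E]
  {G : Type*} [TopologicalSpace G] [ChartedSpace F G] [Group G] [LieGroup 𝓘(ℝ, F) ∞ G]
  {M : Type*} [TopologicalSpace M] [ChartedSpace E M] [IsManifold 𝓘(ℝ, E) ∞ M]
  [MulAction G M] [ContMDiffSMul 𝓘(ℝ, F) 𝓘(ℝ, E) ∞ G M]

theorem contMDiff_orbit (f : C^∞⟮𝓘(ℝ, E), M; ℝ⟯) (m : M) :
    ContMDiff 𝓘(ℝ, F) 𝓘(ℝ, ℝ) ∞ (fun g : G => f (g • m)) :=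
  contMDiff_slice (pullback (act F E G M) f) m

theorem lieDerivative_fundamentalField_apply (X : LieAlg F G) (f : C^∞⟮𝓘(ℝ, E), M; ℝ⟯) (m : M) :
    lieDerivative (fundamentalField X) f m = derivAt F (fun g : G => f (g • m)) 1 X := by
  have hact : ContMDiff 𝓘(ℝ, F) 𝓘(ℝ, E) ∞ (fun g : G => g • m) :=
    (act F E G M).contMDiff.comp (contMDiff_id.prodMk contMDiff_const)
  have h := congrArg (fun L => L X) (mfderiv_comp (I := 𝓘(ℝ, F)) (I' := 𝓘(ℝ, E))
    (I'' := 𝓘(ℝ, ℝ)) (g := f) (f := fun g : G => g • m) 1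
    (f.contMDiff.mdifferentiable infty_ne_zero _) (hact.mdifferentiable infty_ne_zero 1))
  have h2 : ∀ m' : M, m' = m → ∀ v : E,
      (mfderiv 𝓘(ℝ, E) 𝓘(ℝ, ℝ) f m v : ℝ) = (mfderiv 𝓘(ℝ, E) 𝓘(ℝ, ℝ) f m' v : ℝ) := by
    rintro m' rfl v
    rfl
  exact (h2 _ (one_smul G m) _).trans h.symm

theorem unitDeriv_act (X : LieAlg F G) (f : C^∞⟮𝓘(ℝ, E), M; ℝ⟯) :
    unitDeriv F E G M X (pullback (act F E G M) f) = lieDerivative (fundamentalField X) f := by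
  ext m
  exact (lieDerivative_fundamentalField_apply X f m).symm

/-- Fundamental vector fields bracket like right-invariant ones. -/
theorem lieDerivative_fundamentalField_lie [T2Space G] (X Y : LieAlg F G)
    (f : C^∞⟮𝓘(ℝ, E), M; ℝ⟯) :
    lieDerivative (fundamentalField ⁅X, Y⁆) f =
      lieDerivative (fundamentalField Y) (lieDerivative (fundamentalField X) f) -
        lieDerivative (fundamentalField X) (lieDerivative (fundamentalField Y) f) := by
  ext m
  let φ : G → ℝ := fun g => f (g • m)
  have hφ : ContMDiff 𝓘(ℝ, F) 𝓘(ℝ, ℝ) ∞ φ := contMDiff_orbit f m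
  -- Along an orbit, X^♯ f at g • m differentiates k ↦ f(k g • m). The iterated derivative is thus a
  -- right-then-left second derivative of the orbit function, with arguments exchanged by symmetry.
  have key (X Y : LieAlg F G) :
      lieDerivative (fundamentalField Y) (lieDerivative (fundamentalField X) f) m =
        derivAt F (leftDeriv F φ) 1 X Y := by
    rw [lieDerivative_fundamentalField_apply]
    have h1 : (fun g : G => lieDerivative (fundamentalField X) f (g • m)) =
        fun g => derivAt F (fun k => φ (k * g)) 1 X := by
      ext g
      rw [lieDerivative_fundamentalField_apply]
      simp only [φ, mul_smul]
    have h2 : ContMDiff 𝓘(ℝ, F) 𝓘(ℝ, F →L[ℝ] ℝ) ∞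
        (fun g => derivAt F (fun k => φ (k * g)) (1 : G)) :=
      contMDiff_derivAt_right (ψ := fun p : G × G => φ (p.2 * p.1))
        (hφ.comp (contMDiff_snd.mul contMDiff_fst)) 1
    rw [h1]
    exact (derivAt_clm_apply (h2.mdifferentiable infty_ne_zero 1) (X : F) (Y : F)).trans
      (derivAt_derivAt_mul_right hφ X Y)
  have h := derivAt_leftDeriv_sub_eq_lie hφ X Y
  have e : lieDerivative (fundamentalField ⁅X, Y⁆) f m = derivAt F φ 1 (⁅X, Y⁆ : LieAlg F G) :=
    lieDerivative_fundamentalField_apply _ f m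
  change lieDerivative (fundamentalField ⁅X, Y⁆) f m =
    lieDerivative (fundamentalField Y) (lieDerivative (fundamentalField X) f) m -
      lieDerivative (fundamentalField X) (lieDerivative (fundamentalField Y) f) m
  rw [e, key X Y, key Y X]
  refine (neg_eq_iff_eq_neg.1 h.symm).trans ?_
  exact neg_sub _ _

theorem derivAt_adjoint_inv_apply [T2Space G] (l : F →L[ℝ] ℝ) (X Y : LieAlg F G) :
    derivAt F (fun g : G => l (adjoint g⁻¹ Y)) 1 X = l (-⁅X, Y⁆ : LieAlg F G) := by
  have hd := contMDiff_adjoint_inv (F := F) (G := G)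
  refine (derivAt_clm_comp l ((hd.clm_apply contMDiff_const).mdifferentiable infty_ne_zero 1)
    (X : F)).trans (congrArg l ?_)
  exact (derivAt_clm_apply (hd.mdifferentiable infty_ne_zero 1) (Y : F) (X : F)).trans
    (derivAt_adjoint_inv X Y)

/-- Infinitesimal equivariance. -/
theorem lieDerivative_comoment [T2Space G] (μ : MomentMap F E G M) (X Y : LieAlg F G) :
    lieDerivative (fundamentalField X) (μ.comoment Y) = -μ.comoment ⁅X, Y⁆ := by
  ext m
  rw [lieDerivative_fundamentalField_apply]
  have h : (fun g : G => μ.comoment Y (g • m)) = fun g => μ.toFun m (adjoint g⁻¹ Y) := by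
    ext g
    exact μ.equivariant g m Y
  rw [h, derivAt_adjoint_inv_apply]
  exact map_neg (μ.toFun m) _

theorem unitDeriv_adjointCoeff [T2Space G] (σ : Module.Dual ℝ (LieAlg F G)) (X Y : LieAlg F G) :
    unitDeriv F E G M X (adjointCoeff E M σ Y) = algebraMap ℝ _ (σ (-⁅X, Y⁆)) := by
  ext m
  exact derivAt_adjoint_inv_apply (LinearMap.toContinuousLinearMap (E := F) (F' := ℝ) σ) X Y

theorem unit_adjointCoeff (σ : Module.Dual ℝ (LieAlg F G)) (X : LieAlg F G) :
    pullback (unit F E G M) (adjointCoeff E M σ X) = algebraMap ℝ _ (σ X) := by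
  ext m
  have h : (adjoint (1 : G)⁻¹ : F →L[ℝ] F) X = X := by
    rw [inv_one, adjoint_one]
    rfl
  exact congrArg σ h

theorem targetPullback_ofBase (f : C^∞⟮𝓘(ℝ, E), M; ℝ⟯) :
    targetPullback F E G M (Koszul.ofBase f) = Koszul.ofBase (pullback (act F E G M) f) := by
  refine (Algebra.TensorProduct.lift_tmul _ _ _ _ _).trans ?_
  rw [map_one, mul_one]
  rfl

theorem targetPullback_generator (X : LieAlg F G) :
    targetPullback F E G M (Koszul.generator X) =
      ∑ i, Koszul.ofBase (adjointCoeff E M ((Module.finBasis ℝ (LieAlg F G)).coord i) X) *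
        Koszul.generator (Module.finBasis ℝ (LieAlg F G) i) := by
  refine (Algebra.TensorProduct.lift_tmul _ _ _ _ _).trans ?_
  rw [map_one, one_mul, ExteriorAlgebra.lift_ι_apply, LinearMap.comp_apply, adjointTensor,
    LinearMap.sum_apply, map_sum]
  refine Finset.sum_congr rfl fun i _ => ?_
  rw [Koszul.generator_apply, Koszul.ofBase_mul_tmul, mul_one]
  rfl

theorem sum_algebraMap_mul_generator {R V : Type*} [CommRing R] [Algebra ℝ R] [AddCommGroup V]
    [Module ℝ V] {ι : Type*} [Fintype ι] (b : Module.Basis ι ℝ V) (v : V) :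
    ∑ i, Koszul.ofBase (algebraMap ℝ R (b.coord i v)) * Koszul.generator (b i) =
      (Koszul.generator v : Koszul R V) := by
  conv_rhs => rw [← b.sum_repr v, map_sum]
  refine Finset.sum_congr rfl fun i _ => ?_
  rw [AlgHom.commutes, ← Algebra.smul_def, map_smul]
  rfl

/-- The groupoid identity t ∘ u = id, using 1 • m = m and Ad_1 = id. It turns a derivation along u,
composed with `t^*`, into a derivation of C^∞(𝒵). -/
theorem unitPullback_targetPullback (z : FnZ F E G M) :
    unitPullback F E G M (targetPullback F E G M z) = z := by
  induction z using Koszul.induction with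
  | ofBase f =>
    rw [targetPullback_ofBase, unitPullback_ofBase]
    congr 1
    ext m
    exact congrArg f (one_smul G m)
  | generator_mul v z hz =>
    have h (w : LieAlg F G) : unitPullback F E G M (Koszul.generator w) = Koszul.generator w := by
      rw [Koszul.generator_apply, unitPullback, Algebra.TensorProduct.map_tmul, map_one]
      rfl
    rw [map_mul, map_mul, hz, targetPullback_generator, map_sum]
    congr 1
    rw [← sum_algebraMap_mul_generator (Module.finBasis ℝ (LieAlg F G)) v]
    refine Finset.sum_congr rfl fun i _ => ?_
    rw [map_mul, h, unitPullback_ofBase, unit_adjointCoeff]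
  | add y z hy hz => rw [map_add, map_add, hy, hz]

variable (F E G M) in
/-- The infinitesimal action of `𝔤` on `C^∞(𝒵)`. -/
def actionDeriv : LieAlg F G →ₗ[ℝ] Module.End ℝ (FnZ F E G M) :=
  (anchor F E G M).restrictScalars ℝ ∘ₗ (psi F E G M).restrictScalars ℝ ∘ₗ
    TensorProduct.mk ℝ (FnZ F E G M) (LieAlg F G) 1

theorem actionDeriv_apply (X : LieAlg F G) (z : FnZ F E G M) :
    actionDeriv F E G M X z =
      LinearMap.rTensor _ (unitDeriv F E G M X) (targetPullback F E G M z) := by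
  change psi F E G M (1 ⊗ₜ X) (targetPullback F E G M z) = _
  rw [psi_tmul, one_mul]

theorem anchor_psi_tmul (a : FnZ F E G M) (X : LieAlg F G) :
    anchor F E G M (psi F E G M (a ⊗ₜ X)) = a • actionDeriv F E G M X := by
  have h : a ⊗ₜ[ℝ] X = a • ((1 : FnZ F E G M) ⊗ₜ[ℝ] X) := by
    rw [TensorProduct.smul_tmul', smul_eq_mul, mul_one]
  rw [h, map_smul, map_smul]
  rfl

theorem actionDeriv_mul (X : LieAlg F G) (y z : FnZ F E G M) :
    actionDeriv F E G M X (y * z) =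
      actionDeriv F E G M X y * z + y * actionDeriv F E G M X z := by
  have h := Koszul.rTensor_mul (V := LieAlg F G) (unitDeriv_mul (E := E) (M := M) X)
    (targetPullback F E G M y) (targetPullback F E G M z)
  rw [actionDeriv_apply, map_mul, h, actionDeriv_apply, actionDeriv_apply]
  congr 2
  · exact unitPullback_targetPullback z
  · exact unitPullback_targetPullback y

theorem actionDeriv_ofBase (X : LieAlg F G) (f : C^∞⟮𝓘(ℝ, E), M; ℝ⟯) :
    actionDeriv F E G M X (Koszul.ofBase f) =
      Koszul.ofBase (lieDerivative (fundamentalField X) f) := by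
  rw [actionDeriv_apply, targetPullback_ofBase, Koszul.rTensor_ofBase, unitDeriv_act]

theorem actionDeriv_generator [T2Space G] (X Y : LieAlg F G) :
    actionDeriv F E G M X (Koszul.generator Y) = -Koszul.generator ⁅X, Y⁆ := by
  rw [actionDeriv_apply, targetPullback_generator, map_sum, ← map_neg,
    ← sum_algebraMap_mul_generator (Module.finBasis ℝ (LieAlg F G)) (-⁅X, Y⁆)]
  refine Finset.sum_congr rfl fun i _ => ?_
  rw [Koszul.ofBase_comm, Koszul.rTensor_generator_mul, Koszul.rTensor_ofBase,
    unitDeriv_adjointCoeff, ← Koszul.ofBase_comm]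

theorem actionDeriv_generator_mul [T2Space G] (X Y : LieAlg F G) (z : FnZ F E G M) :
    actionDeriv F E G M X (Koszul.generator Y * z) =
      -Koszul.generator ⁅X, Y⁆ * z + Koszul.generator Y * actionDeriv F E G M X z := by
  rw [actionDeriv_mul, actionDeriv_generator]

theorem actionDeriv_mem_degree [T2Space G] (X : LieAlg F G) {n : ℤ} {z : FnZ F E G M}
    (hz : z ∈ Koszul.degree C^∞⟮𝓘(ℝ, E), M; ℝ⟯ (LieAlg F G) n) :
    actionDeriv F E G M X z ∈ Koszul.degree C^∞⟮𝓘(ℝ, E), M; ℝ⟯ (LieAlg F G) n := by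
  induction hz using Koszul.degree_induction with
  | zero n => simp
  | add n y z _ _ hy hz => rw [map_add]; exact add_mem hy hz
  | ofBase f => rw [actionDeriv_ofBase]; exact Koszul.ofBase_mem_degree _
  | generator_mul n v z hz ih =>
    rw [actionDeriv_generator_mul, neg_mul]
    exact add_mem (neg_mem (Koszul.generator_mul_mem_degree _ hz))
      (Koszul.generator_mul_mem_degree v ih)

/-- Both sides obey a Leibniz rule. On functions this is the bracket of fundamental fields, and on
generators the Jacobi identity. -/
theorem actionDeriv_lie [T2Space G] (X Y : LieAlg F G) (z : FnZ F E G M) :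
    actionDeriv F E G M ⁅X, Y⁆ z = actionDeriv F E G M Y (actionDeriv F E G M X z) -
      actionDeriv F E G M X (actionDeriv F E G M Y z) := by
  induction z using Koszul.induction with
  | ofBase f =>
    simp only [actionDeriv_ofBase, lieDerivative_fundamentalField_lie, map_sub]
  | generator_mul v z hz =>
    simp only [actionDeriv_generator_mul, map_add, map_neg, neg_mul, hz, mul_sub]
    rw [lie_lie X Y v, map_sub, sub_mul]
    abel
  | add y z hy hz => simp only [map_add, hy, hz]; abel

/-- On a generator Y this is infinitesimal equivariance of μ; the Leibniz rules propagate it. -/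
theorem actionDeriv_diffZ [T2Space G] (μ : MomentMap F E G M) (X : LieAlg F G)
    (z : FnZ F E G M) :
    actionDeriv F E G M X (μ.diffZ z) = μ.diffZ (actionDeriv F E G M X z) := by
  rw [MomentMap.diffZ]
  induction z using Koszul.induction with
  | ofBase f =>
    rw [Koszul.differential_ofBase, actionDeriv_ofBase, Koszul.differential_ofBase, map_zero]
  | generator_mul v z hz =>
    rw [Koszul.differential_generator_mul, map_sub, actionDeriv_mul, actionDeriv_ofBase,
      lieDerivative_comoment, actionDeriv_generator_mul, hz, actionDeriv_generator_mul, map_add]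
    simp only [neg_mul, map_neg, Koszul.differential_generator_mul]
    abel
  | add y z hy hz => simp only [map_add, hy, hz]

/-! ### The anchor is `ρ₀ + η` -/

theorem rhoZero_tmul (a : FnZ F E G M) (X : LieAlg F G) :
    rhoZero F E G M (a ⊗ₜ X) = a ⊗ₜ fundamentalField X := by
  rw [rhoZero, extendScalars_tmul]
  change a • ((1 : FnZ F E G M) ⊗ₜ[C^∞⟮𝓘(ℝ, E), M; ℝ⟯] fundamentalField X) = _
  rw [TensorProduct.smul_tmul', smul_eq_mul, mul_one]

theorem endDualEquiv_eq_sum (T : Module.End ℝ (Module.Dual ℝ (LieAlg F G))) :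
    endDualEquiv G T = ∑ i, Module.finBasis ℝ (LieAlg F G) i ⊗ₜ[ℝ]
      T ((Module.finBasis ℝ (LieAlg F G)).coord i) := by
  have h (v : LieAlg F G) (τ σ : Module.Dual ℝ (LieAlg F G)) :
      (endDualEquiv G).symm (v ⊗ₜ τ) σ = σ v • τ := by
    simp [endDualEquiv]
  rw [← LinearEquiv.eq_symm_apply, map_sum]
  ext1 σ
  rw [LinearMap.sum_apply]
  simp only [h]
  conv_lhs => rw [← (Module.finBasis ℝ (LieAlg F G)).sum_dual_apply_smul_coord σ]
  rw [map_sum]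
  simp only [map_smul]

theorem eta_tmul (a : FnZ F E G M) (X : LieAlg F G) :
    eta F E G M (a ⊗ₜ X) = ∑ i, (a * Koszul.generator (Module.finBasis ℝ (LieAlg F G) i)) ⊗ₜ[ℝ]
      coadjoint X ((Module.finBasis ℝ (LieAlg F G)).coord i) := by
  rw [eta, extendScalars_tmul, LinearMap.comp_apply, LinearMap.comp_apply, LinearEquiv.coe_coe,
    endDualEquiv_eq_sum, map_sum, Finset.smul_sum]
  rfl

theorem horizontal_tmul (a : FnZ F E G M) (W : VectorFields 𝓘(ℝ, E) M) (z : FnZ F E G M) :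
    horizontal F E G M (a ⊗ₜ W) z =
      a * LinearMap.rTensor (ExteriorAlgebra ℝ (LieAlg F G)) (lieDerivative W) z := rfl

theorem toTangent_rhoZero_eta [T2Space G] (x : TrivZ F E G M) :
    anchor F E G M (psi F E G M x) = toTangent F E G M (rhoZero F E G M x, eta F E G M x) := by
  have key (X : LieAlg F G) : actionDeriv F E G M X =
      toTangent F E G M (rhoZero F E G M (1 ⊗ₜ X), eta F E G M (1 ⊗ₜ X)) := by
    let b := Module.finBasis ℝ (LieAlg F G)
    have hT (z : FnZ F E G M) :
        toTangent F E G M (rhoZero F E G M (1 ⊗ₜ X), eta F E G M (1 ⊗ₜ X)) z =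
          LinearMap.rTensor (ExteriorAlgebra ℝ (LieAlg F G))
            (lieDerivative (fundamentalField X)) z +
          ∑ i, Koszul.generator (b i) * Koszul.contract (1 ⊗ₜ coadjoint X (b.coord i)) z := by
      rw [toTangent, LinearMap.coprod_apply, LinearMap.add_apply, rhoZero_tmul, horizontal_tmul,
        one_mul, eta_tmul, map_sum, LinearMap.sum_apply]
      congr 1
      refine Finset.sum_congr rfl fun i _ => ?_
      rw [Koszul.contract_tmul, one_mul]
    -- Both operators send v to -⁅X, v⁆ and act on functions by X^♯. For the right-hand side, the
    -- basis sum in η reassembles -⁅X, v⁆ from its components.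
    refine Koszul.hom_ext_of_leibniz (fun v => -Koszul.generator ⁅X, v⁆)
      (fun v z => actionDeriv_generator_mul X v z) (fun v z => ?_) fun f => ?_
    · rw [hT, hT, Koszul.rTensor_generator_mul, mul_add, Finset.mul_sum, add_left_comm,
        ← map_neg, ← sum_algebraMap_mul_generator b (-⁅X, v⁆), Finset.sum_mul,
        ← Finset.sum_add_distrib]
      congr 1
      refine Finset.sum_congr rfl fun i _ => ?_
      rw [Koszul.contract_one_tmul_generator_mul, mul_sub, ← mul_assoc,
        Koszul.generator_mul_generator, neg_mul, sub_neg_eq_add, mul_assoc, AlgHom.commutes,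
        ← Algebra.smul_def, mul_smul_comm, smul_mul_assoc]
      have hc : coadjoint X (b.coord i) v = b.coord i (-⁅X, v⁆) := (map_neg (b.coord i) _).symm
      rw [hc]
    · rw [hT, actionDeriv_ofBase, Koszul.rTensor_ofBase]
      simp [Koszul.contract_one_tmul_ofBase]
  let ρ := toTangent F E G M ∘ₗ (rhoZero F E G M).prod (eta F E G M)
  change anchor F E G M (psi F E G M x) = ρ x
  induction x using TensorProduct.induction_on with
  | zero => simp only [map_zero]
  | add x y hx hy => simp only [map_add, hx, hy]
  | tmul a X =>
    have h : a ⊗ₜ[ℝ] X = a • ((1 : FnZ F E G M) ⊗ₜ[ℝ] X) := by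
      rw [TensorProduct.smul_tmul', smul_eq_mul, mul_one]
    rw [anchor_psi_tmul, key, h]
    exact (map_smul ρ a _).symm

end Anchor

/-! ### Tangent values, the homotopy and the algebroid structure -/

section ActionAlgebroid

set_option linter.unusedSectionVars false

variable {F E : Type*} [NormedAddCommGroup F] [NormedSpace ℝ F] [FiniteDimensional ℝ F]
  [NormedAddCommGroup E] [NormedSpace ℝ E]
  {G : Type*} [TopologicalSpace G] [ChartedSpace F G] [Group G] [LieGroup 𝓘(ℝ, F) ∞ G]
  {M : Type*} [TopologicalSpace M] [ChartedSpace E M] [IsManifold 𝓘(ℝ, E) ∞ M]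
  [MulAction G M] [ContMDiffSMul 𝓘(ℝ, F) 𝓘(ℝ, E) ∞ G M]

/-- The chain rule for fundamental vector fields. -/
theorem lieDerivative_fundamentalField_substitute (X : LieAlg F G) {k : ℕ} {Φ : (Fin k → ℝ) → ℝ}
    (hΦ : ContDiff ℝ ∞ Φ) (a : Fin k → C^∞⟮𝓘(ℝ, E), M; ℝ⟯) :
    lieDerivative (fundamentalField X) (substitute Φ hΦ a) =
      ∑ i, substitute _ (contDiff_partial hΦ i) a * lieDerivative (fundamentalField X) (a i) := by
  ext m
  have ha : MDifferentiableAt 𝓘(ℝ, F) 𝓘(ℝ, Fin k → ℝ) (fun (g : G) i => a i (g • m)) 1 :=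
    (contMDiff_pi_space.2 fun i => contMDiff_orbit (a i) m).mdifferentiable infty_ne_zero 1
  let w : Fin k → ℝ := derivAt F (fun (g : G) i => a i (g • m)) 1 X
  have hw (i : Fin k) : w i = lieDerivative (fundamentalField X) (a i) m :=
    (derivAt_clm_comp (ContinuousLinearMap.proj i) ha (X : F)).symm.trans
      (lieDerivative_fundamentalField_apply X (a i) m).symm
  have h1 : lieDerivative (fundamentalField X) (substitute Φ hΦ a) m =
      fderiv ℝ Φ (fun i => a i m) w := by
    refine (lieDerivative_fundamentalField_apply X _ m).trans ?_
    refine (congrArg (fun L : F →L[ℝ] ℝ => L X)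
      (derivAt_comp (hΦ.differentiable (by simp) _) ha)).trans ?_
    change fderiv ℝ Φ (fun i => a i ((1 : G) • m)) w = _
    rw [one_smul]
  rw [h1]
  refine Eq.trans ?_ (map_sum (ContMDiffMap.evalRingHom (I := 𝓘(ℝ, E)) (I' := 𝓘(ℝ, ℝ)) (n := ∞) m)
    _ _).symm
  conv_lhs => rw [pi_eq_sum_univ' w, map_sum]
  refine Finset.sum_congr rfl fun i _ => ?_
  have e : (fun j => if i = j then (1 : ℝ) else 0) = Pi.single i 1 := by
    ext j
    simp [Pi.single_apply, eq_comm]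
  rw [map_smul, hw, smul_eq_mul, mul_comm]
  rfl

theorem anchor_psi_mem_tangentModule [T2Space G] {n : ℤ} {x : TrivZ F E G M}
    (hx : x ∈ trivDegree F E G M n) :
    anchor F E G M (psi F E G M x) ∈ tangentModule 𝓘(ℝ, E) M (LieAlg F G) n := by
  refine tensorDegree_induction
    (p := fun x => anchor F E G M (psi F E G M x) ∈ tangentModule 𝓘(ℝ, E) M (LieAlg F G) n)
    (by simp) (fun x y hx hy => by rw [map_add, map_add]; exact add_mem hx hy)
    (fun a ha X => ?_) hx
  rw [anchor_psi_tmul]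
  refine ⟨⟨fun k g hg => ?_, fun k g hg l h _ => ?_⟩, fun k Φ hΦ f => ?_⟩
  · rw [add_comm]
    exact Koszul.mul_mem_degree ha (actionDeriv_mem_degree X hg)
  · simp only [LinearMap.smul_apply, smul_eq_mul, actionDeriv_mul, mul_add, AlgHom.id_apply]
    rw [← mul_assoc, ← mul_assoc, Koszul.mul_comm_degree ha hg, smul_mul_assoc, mul_assoc g]
  · simp only [LinearMap.smul_apply, smul_eq_mul, actionDeriv_ofBase,
      lieDerivative_fundamentalField_substitute, map_sum, map_mul, Finset.mul_sum,
      Koszul.ofBase_left_comm]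

/-- The chain rule is not imposed on elements of A; it follows from surjectivity of Ψ and the chain
rule for fundamental fields. -/
theorem anchor_mem_tangentModule [T2Space G] {n : ℤ} {α : FnGZ F E G M →ₗ[ℝ] FnZ F E G M}
    (hα : α ∈ algebroid F E G M n) :
    anchor F E G M α ∈ tangentModule 𝓘(ℝ, E) M (LieAlg F G) n := by
  obtain ⟨x, hx, rfl⟩ := (bijOn_psi n).surjOn hα
  exact anchor_psi_mem_tangentModule hx

/-! ### The chain homotopy -/

/-- Infinitesimal equivariance turns Y ↦ X^♯ μ^Y into -μ^{⁅X, Y⁆}, and expanding ⁅X, Y⁆ in a basis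
gives the sum. It is the sum for η with each generator e_i replaced by δe_i = μ^{e_i}. -/
theorem MomentMap.dmu_rhoZero_tmul [T2Space G] (μ : MomentMap F E G M) (a : FnZ F E G M)
    (X : LieAlg F G) :
    μ.dmu (rhoZero F E G M (a ⊗ₜ X)) =
      ∑ i, (a * Koszul.ofBase (μ.comoment (Module.finBasis ℝ (LieAlg F G) i))) ⊗ₜ[ℝ]
        coadjoint X ((Module.finBasis ℝ (LieAlg F G)).coord i) := by
  have h : μ.dmu (rhoZero F E G M (a ⊗ₜ X)) = a • Koszul.ofHom (Koszul.ofBase.toLinearMap ∘ₗ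
      lieDerivative (fundamentalField X) ∘ₗ μ.comoment) := by
    rw [rhoZero_tmul]
    rfl
  have h2 : Koszul.ofBase.toLinearMap ∘ₗ lieDerivative (fundamentalField X) ∘ₗ μ.comoment =
      ∑ i, LinearMap.smulRight (coadjoint X ((Module.finBasis ℝ (LieAlg F G)).coord i))
        (Koszul.ofBase (μ.comoment (Module.finBasis ℝ (LieAlg F G) i)) : FnZ F E G M) := by
    refine LinearMap.ext fun Y => ?_
    rw [LinearMap.sum_apply]
    refine (congrArg Koszul.ofBase (lieDerivative_comoment μ X Y)).trans ?_
    rw [← map_neg μ.comoment]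
    conv_lhs => rw [← (Module.finBasis ℝ (LieAlg F G)).sum_repr (-⁅X, Y⁆), map_sum, map_sum]
    refine Finset.sum_congr rfl fun i _ => ?_
    have hc : coadjoint X ((Module.finBasis ℝ (LieAlg F G)).coord i) Y =
      (Module.finBasis ℝ (LieAlg F G)).coord i (-⁅X, Y⁆) :=
      (map_neg ((Module.finBasis ℝ (LieAlg F G)).coord i) _).symm
    rw [map_smul, map_smul, LinearMap.smulRight_apply, hc]
    rfl
  rw [h, h2, map_sum, Finset.smul_sum]
  refine Finset.sum_congr rfl fun i _ => ?_
  rw [← Koszul.tmul_eq_ofHom, TensorProduct.smul_tmul', smul_eq_mul]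

theorem etaHomotopy_tmul {n : ℤ} {a : FnZ F E G M}
    (ha : a ∈ Koszul.degree C^∞⟮𝓘(ℝ, E), M; ℝ⟯ (LieAlg F G) n) (X : LieAlg F G) :
    etaHomotopy F E G M (a ⊗ₜ X) = (-1 : ℝ) ^ n • eta F E G M (a ⊗ₜ X) := by
  change eta F E G M (Koszul.signInvolution a ⊗ₜ X) = _
  rw [Koszul.signInvolution_apply ha, ← TensorProduct.smul_tmul']
  exact map_smul ((eta F E G M).restrictScalars ℝ) _ _

/-- The homotopy computation with g_i for the generators and c_i for their differentials: the terms
δa · g_i occur with signs (-1)^n and (-1)^{n+1} and cancel, leaving a · c_i. -/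
theorem sum_tmul_eq_rTensor_add {A W ι : Type*} [Ring A] [Algebra ℝ A] [AddCommGroup W]
    [Module ℝ W] [Fintype ι] {δ : A →ₗ[ℝ] A} {n : ℤ} {a : A} {g c : ι → A} {τ : ι → W}
    (h : ∀ i, δ (a * g i) = δ a * g i + (-1 : ℝ) ^ n • (a * c i)) :
    ∑ i, (a * c i) ⊗ₜ[ℝ] τ i = LinearMap.rTensor W δ ((-1 : ℝ) ^ n • ∑ i, (a * g i) ⊗ₜ[ℝ] τ i) +
      (-1 : ℝ) ^ (n + 1) • ∑ i, (δ a * g i) ⊗ₜ[ℝ] τ i := by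
  have hs : (-1 : ℝ) ^ (n + 1) = -(-1 : ℝ) ^ n := by
    rw [zpow_add₀ (by norm_num), zpow_one, mul_neg_one]
  rw [map_smul, map_sum, Finset.smul_sum, Finset.smul_sum, ← Finset.sum_add_distrib]
  refine Finset.sum_congr rfl fun i _ => ?_
  rw [LinearMap.rTensor_tmul, TensorProduct.smul_tmul', TensorProduct.smul_tmul',
    ← TensorProduct.add_tmul, h, smul_add, neg_one_zpow_smul_smul, hs, neg_smul]
  congr 1
  abel

theorem dmu_rhoZero_eq_homotopy [T2Space G] (μ : MomentMap F E G M) (x : TrivZ F E G M) :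
    μ.dmu (rhoZero F E G M x) =
      μ.diffTriv (Module.Dual ℝ (LieAlg F G)) (etaHomotopy F E G M x) +
        etaHomotopy F E G M (μ.diffTriv (LieAlg F G) x) := by
  induction x using TensorProduct.induction_on with
  | zero => simp
  | add x y hx hy => simp only [map_add, hx, hy]; abel
  | tmul a X =>
    induction a using Koszul.induction_degree with
    | add y z hy hz => simp only [TensorProduct.add_tmul, map_add, hy, hz]; abel
    | mem n a ha =>
      have hδ : μ.diffZ a ∈ Koszul.degree C^∞⟮𝓘(ℝ, E), M; ℝ⟯ (LieAlg F G) (n + 1) :=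
        Koszul.differential_mem_degree _ ha
      have hg (v : LieAlg F G) :
          μ.diffZ (Koszul.generator v) = Koszul.ofBase (μ.comoment v) := by
        have h := Koszul.differential_generator_mul μ.comoment v (Koszul.ofBase 1)
        rwa [Koszul.differential_ofBase, map_one, mul_one, mul_one, mul_zero, sub_zero] at h
      have hd : μ.diffTriv (LieAlg F G) (a ⊗ₜ X) = μ.diffZ a ⊗ₜ X := rfl
      have hm (v : LieAlg F G) : μ.diffZ (a * Koszul.generator v) =
          μ.diffZ a * Koszul.generator v + (-1 : ℝ) ^ n • (a * Koszul.ofBase (μ.comoment v)) := by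
        rw [← hg]
        exact Koszul.differential_mul _ ha _
      rw [hd, etaHomotopy_tmul ha, etaHomotopy_tmul hδ, μ.dmu_rhoZero_tmul, eta_tmul, eta_tmul]
      exact sum_tmul_eq_rTensor_add fun i => hm _

theorem isDGLieAlgebroid_trivZ [T2Space G] (μ : MomentMap F E G M) :
    IsDGLieAlgebroid (Koszul.degree C^∞⟮𝓘(ℝ, E), M; ℝ⟯ (LieAlg F G)) μ.diffZ
      (tangentModule 𝓘(ℝ, E) M (LieAlg F G)) (trivDegree F E G M) (μ.diffTriv (LieAlg F G))
      (toTangent F E G M ∘ₗ (rhoZero F E G M).prod (eta F E G M))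
      (actionBracket (actionDeriv F E G M)) := by
  have hρ (x : TrivZ F E G M) :
      (toTangent F E G M ∘ₗ (rhoZero F E G M).prod (eta F E G M)) x =
        anchor F E G M (psi F E G M x) := (toTangent_rhoZero_eta x).symm
  exact isDGLieAlgebroid_actionBracket
    (fun _ _ _ ha _ hb => Koszul.mul_mem_degree ha hb)
    (fun _ _ _ ha _ hb => Koszul.mul_comm_degree ha hb)
    (fun _ _ ha => Koszul.differential_mem_degree _ ha)
    (Koszul.differential_differential _)
    (fun _ _ ha b => Koszul.differential_mul _ ha b)
    (fun X _ _ ha => actionDeriv_mem_degree X ha) actionDeriv_mul actionDeriv_lie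
    (actionDeriv_diffZ μ) (fun a X => (hρ _).trans (anchor_psi_tmul a X))
    (fun _ _ hx => (hρ _).symm ▸ anchor_psi_mem_tangentModule hx)

/-- A derivation kills 1, so only the bracket term of the defining formula remains. -/
theorem actionBracket_one_tmul [T2Space G] (X Y : LieAlg F G) :
    actionBracket (actionDeriv F E G M) (1 ⊗ₜ X) (1 ⊗ₜ Y) = -(1 ⊗ₜ ⁅X, Y⁆) := by
  have h (Z : LieAlg F G) : actionDeriv F E G M Z 1 = 0 := by
    simpa using actionDeriv_mul (E := E) (M := M) Z 1 1
  rw [actionBracket_tmul, h, h, mul_zero, zero_mul, one_mul, TensorProduct.zero_tmul,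
    TensorProduct.zero_tmul, sub_zero, zero_sub]

end ActionAlgebroid

end DerivedReduction

end

/-! ### The theorem -/

theorem proposition6
    {F E : Type*} [NormedAddCommGroup F] [NormedSpace ℝ F] [FiniteDimensional ℝ F]
    [NormedAddCommGroup E] [NormedSpace ℝ E] [FiniteDimensional ℝ E]
    -- a Lie group `G` acting smoothly on a manifold `M`
    {G : Type*} [TopologicalSpace G] [ChartedSpace F G] [T2Space G] [Group G]
    [LieGroup 𝓘(ℝ, F) ∞ G]
    {M : Type*} [TopologicalSpace M] [ChartedSpace E M] [T2Space M] [IsManifold 𝓘(ℝ, E) ∞ M]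
    [MulAction G M] [ContMDiffSMul 𝓘(ℝ, F) 𝓘(ℝ, E) ∞ G M]
    (μ : MomentMap F E G M) :
    ∃ Ψ : TrivZ F E G M →ₗ[FnZ F E G M] (FnGZ F E G M →ₗ[ℝ] FnZ F E G M),
      -- `Ψ(1 ⊗ X)` differentiates functions on `G × M` along `X` at the unit
      (∀ (X : LieAlg F G) (f : C^∞⟮𝓘(ℝ, F).prod 𝓘(ℝ, E), G × M; ℝ⟯),
        ∃ b : C^∞⟮𝓘(ℝ, E), M; ℝ⟯,
          (∀ m, b m = mfderiv 𝓘(ℝ, F) 𝓘(ℝ, ℝ) (fun g : G => f (g, m)) 1 X) ∧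
          Ψ (1 ⊗ₜ X) (Koszul.ofBase f) = Koszul.ofBase b) ∧
      -- `Ψ` is an isomorphism of dg-modules onto the `u`-derivations vanishing along `s`
      (∀ n, Set.BijOn Ψ (trivDegree F E G M n) (algebroid F E G M n)) ∧
      (∀ n, ∀ x ∈ trivDegree F E G M n,
        Ψ (μ.diffTriv (LieAlg F G) x) = homDifferential μ.diffGZ μ.diffZ n (Ψ x)) ∧
      -- the anchor takes values in the tangent module and equals `ρ₀ + η`
      (∀ n, ∀ α ∈ algebroid F E G M n,
        anchor F E G M α ∈ tangentModule 𝓘(ℝ, E) M (LieAlg F G) n) ∧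
      (∀ x, anchor F E G M (Ψ x) = toTangent F E G M (rhoZero F E G M x, eta F E G M x)) ∧
      -- `η` is a chain homotopy between `dμ ∘ ρ₀` and `0`
      (∀ x, μ.dmu (rhoZero F E G M x) =
        μ.diffTriv (Module.Dual ℝ (LieAlg F G)) (etaHomotopy F E G M x) +
          etaHomotopy F E G M (μ.diffTriv (LieAlg F G) x)) ∧
      -- with this anchor, `C^∞(𝒵) ⊗ 𝔤` is a dg-Lie algebroid, with bracket induced from that of `𝔤`
      -- (right-invariant vector fields bracket with the opposite of the bracket of `𝔤`)
      ∃ br : TrivZ F E G M →ₗ[ℝ] TrivZ F E G M →ₗ[ℝ] TrivZ F E G M,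
        IsDGLieAlgebroid (Koszul.degree C^∞⟮𝓘(ℝ, E), M; ℝ⟯ (LieAlg F G)) μ.diffZ
          (tangentModule 𝓘(ℝ, E) M (LieAlg F G))
          (trivDegree F E G M) (μ.diffTriv (LieAlg F G))
          (toTangent F E G M ∘ₗ (rhoZero F E G M).prod (eta F E G M)) br ∧
        ∀ X Y : LieAlg F G, br (1 ⊗ₜ X) (1 ⊗ₜ Y) = -(1 ⊗ₜ ⁅X, Y⁆) := by
  refine ⟨psi F E G M, fun X f => ⟨unitDeriv F E G M X f, fun m => rfl, ?_⟩, bijOn_psi,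
    fun n x hx => psi_diffTriv μ hx, fun n α hα => anchor_mem_tangentModule hα,
    toTangent_rhoZero_eta, dmu_rhoZero_eq_homotopy μ, actionBracket (actionDeriv F E G M),
    isDGLieAlgebroid_trivZ μ, actionBracket_one_tmul⟩
  rw [psi_tmul, one_mul, Koszul.rTensor_ofBase]
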